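/- **Setting.** Let $m\ge 2$, $I=\mathbb Z/m\mathbb Z$, $\alpha\in\mathbb N^I$, $q\in(\mathbb C^\times)^I$, $q_\infty=\prod_{i\in I}q_i^{-\alpha_i}$. Let $\bar Q$ be the double of the framed cyclic quiver, with vertices $I\sqcup\{\infty\}$ and arrows $x_i:i\to i+1$, $y_i=x_i^*:i+1\to i$ $(i\in I)$, $v:0\to\infty$, $w=v^*:\infty\to0$; write $t(a),h(a)$ for the tail and head of an arrow $a$, and $\epsilon(x_i)=\epsilon(v)=1$, $\epsilon(y_i)=\epsilon(w)=-1$. A representation of dimension $(1,\alpha)$ (with $1$ at $\infty$) assigns to each arrow $a$ a complex matrix with rows indexed by a basis at $t(a)$ and columns by a basis at $h(a)$; denote these matrices by $X_i,Y_i,V,W$ and put $X=\sum_iX_i$, $Y=\sum_iY_i$, endomorphisms of $\mathcal V=\bigoplus_{i\in I}\mathbb C^{\alpha_i}$. Let $\operatorname{Rep}(A)$ be the open subset of the space of representations where $1+aa^*$ is invertible for every arrow $a$, and $\operatorname{Rep}(\Lambda)\subset\operatorname{Rep}(A)$ the subset (representations of the multiplicative preprojective algebra) given by $$(\mathrm{Id}+Y_{i-1}X_{i-1})^{-1}(\mathrm{Id}+X_iY_i)=q_i\,\mathrm{Id}\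 (i\ne0),\quad (\mathrm{Id}+Y_{m-1}X_{m-1})^{-1}(\mathrm{Id}+X_0Y_0)(\mathrm{Id}+VW)=q_0\,\mathrm{Id},\quad (1+WV)^{-1}=q_\infty .$$ Let $\mathcal M_{\alpha,q}=\operatorname{Rep}(\Lambda)/\!/\operatorname{GL}$ be the affine quotient by change of bases at the vertices (two representations give the same point iff no invariant regular function separates them), and $\mathcal M_{\alpha,q}^0\subset\mathcal M_{\alpha,q}$ the open subset where $X$ is invertible. Functions on the space of representations carry the quasi-Poisson bracket $\{f,g\}$ of the bivector $$P=\tfrac12\sum_{a}\epsilon(a)(1+a^*a)\frac{\partial}{\partial a}\frac{\partial}{\partial a^*}-\tfrac12\sum_{a<b,\ t(a)=t(b)}F_aF_b,\qquad F_a=\frac{\partial}{\partial a^*}a^*-a\frac{\partial}{\partial a},$$ where the arrows starting at $i\ne0$ are ordered as $y_{i-1}<x_i$ and those starting at $0$ as $y_{m-1}<x_0<v$. Here $\partial/\partial a$ stands for the matrix of vector fields whose $(r,s)$ entry is the partial derivative with respect to the $(s,r)$ entry of $a$, and a product $\delta_1\delta_2$ of two matrices of vector fields gives the bracket $\sum_{r,s}\big((\delta_1)_{rs}(f)(\delta_2)_{sr}(g)-(\delta_2)_{sr}(f)(\delta_1)_{rs}(g)\big)$.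 It induces the Poisson bracket of invariant functions on $\mathcal M_{\alpha,q}$. The Hamiltonian flow of a function $H$ is that of the vector field $\{H,-\}$, with time $t\in\mathbb C$. **Proposition.** Let $k\ge1$ be a multiple of $m$. (1) Let $H_k=\frac1k\operatorname{tr}Y^k$. For every initial position $(X(0),Y(0),V(0),W(0))$ in $\operatorname{Rep}(\Lambda)$ the solution of the Hamiltonian flow of $H_k$ is defined for all $t\in\mathbb C$, stays in $\operatorname{Rep}(\Lambda)$ and is given by $$X(t)=e^{-tY^k}X(0)+Y^{-1}(e^{-tY^k}-1),\quad Y(t)=Y(0),\quad V(t)=V(0),\quad W(t)=W(0),$$ where $Y=Y(0)$ and $Y^{-1}(e^{-tY^k}-1)$ denotes the value at $Y$ of the entire function $z^{-1}(e^{-tz^k}-1)$. (2) Let $G_k=\frac1k\operatorname{tr}Z^k$ with $Z=Y+X^{-1}$, on the locus where $X$ is invertible. For every initial position in $\operatorname{Rep}(\Lambda)$ with $X(0)$ invertible the solution of the Hamiltonian flow of $G_k$ is defined for all $t\in\mathbb C$, stays in $\operatorname{Rep}(\Lambda)$ with $X(t)$ invertible, and is given by $$X(t)=e^{-tZ^k}X(0),\quad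 Z(t)=Z(0),\quad V(t)=V(0),\quad W(t)=W(0),\qquad Z=Z(0).$$ In both cases the statement holds for the flow on the space of representations (on $\operatorname{Rep}(A)$, respectively on its open subset where $X$ is invertible) as well as for the Hamiltonian flow on the quotient, where the solution through the class of the initial position is the class of the curve displayed: these curves are integral curves of $\{H_k,-\}$, respectively $\{G_k,-\}$, and every other integral curve on a connected open set of times containing $0$ with the same initial value coincides with them there. In particular both flows are complete: the first on the whole of $\mathcal M_{\alpha,q}$, the second on $\mathcal M_{\alpha,q}^0$. -/

import Mathlib

open scoped Matrix Nat

namespace CyclicQuiver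

noncomputable section

/-! ### The doubled framed cyclic quiver -/

/-- Arrows of the double of the framed cyclic quiver with vertex set `ZMod m ∪ {∞}`:
`x i : i → i + 1`, `y i : i + 1 → i`, `v : 0 → ∞`, `w : ∞ → 0`. -/
inductive Arrow (m : ℕ) : Type
  | x (i : ZMod m) : Arrow m
  | y (i : ZMod m) : Arrow m
  | v : Arrow m
  | w : Arrow m
  deriving DecidableEq

/-- Auxiliary enumeration of the arrows, used only to see that there are finitely many. -/
def arrowEquiv (m : ℕ) : (ZMod m ⊕ ZMod m ⊕ Bool) ≃ Arrow m where
  toFun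
    | .inl i => .x i
    | .inr (.inl i) => .y i
    | .inr (.inr true) => .v
    | .inr (.inr false) => .w
  invFun
    | .x i => .inl i
    | .y i => .inr (.inl i)
    | .v => .inr (.inr true)
    | .w => .inr (.inr false)
  left_inv := by rintro (i | i | (_ | _)) <;> rfl
  right_inv := by rintro (i | i | _ | _) <;> rfl

instance (m : ℕ) [NeZero m] : Fintype (Arrow m) := Fintype.ofEquiv _ (arrowEquiv m)

namespace Arrow

variable {m : ℕ}

/-- The tail of an arrow; `none` is the framing vertex `∞`. -/
def tail : Arrow m → Option (ZMod m)
  | x i => some i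
  | y i => some (i + 1)
  | v => some 0
  | w => none

/-- The head of an arrow. -/
def head : Arrow m → Option (ZMod m)
  | x i => some (i + 1)
  | y i => some i
  | v => none
  | w => some 0

/-- The opposite arrow `a ↦ a*`. -/
def star : Arrow m → Arrow m
  | x i => y i
  | y i => x i
  | v => w
  | w => v

/-- The sign: `1` on the original arrows `x i`, `v`, and `-1` on their opposites `y i`, `w`. -/
def sign : Arrow m → ℂ
  | x _ => 1
  | y _ => -1
  | v => 1
  | w => -1

/-- This encodes the ordering of the arrows starting at each vertex: at the vertex `i ≠ 0` these
are `y (i - 1) < x i`, at `0` they are `y (-1) < x 0 < v`, and at `∞` there is only `w`. Only the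
comparison of arrows with the same tail is ever used. -/
def rank : Arrow m → ℕ
  | y _ => 0
  | x _ => 1
  | v => 2
  | w => 3

end Arrow

/-! ### Representations of the doubled quiver -/

section Rep

variable {m : ℕ}

/-- The dimension vector `(1, α)`: dimension `1` at `∞` and `α i` at `i`. -/
abbrev dim (α : ZMod m → ℕ) : Option (ZMod m) → ℕ
  | none => 1
  | some i => α i

/-- Index set of the standard basis of `ℂ ⊕ ⨁ i, ℂ ^ (α i)` (framing vertex included). -/
abbrev Idx (α : ZMod m → ℕ) : Type := Σ v : Option (ZMod m), Fin (dim α v)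

/-- Index set of the standard basis of `⨁ i, ℂ ^ (α i)` (framing vertex excluded). -/
abbrev IdxI (α : ZMod m → ℕ) : Type := Σ i : ZMod m, Fin (α i)

/-- The matrix entries of a representation: the arrow `a` is represented by a matrix with one block,
whose rows belong to the tail and whose columns belong to the head of `a`. -/
abbrev Coord (α : ZMod m → ℕ) : Type :=
  {c : Arrow m × Idx α × Idx α // c.2.1.1 = c.1.tail ∧ c.2.2.1 = c.1.head}

/-- The affine space `Rep(ℂ Q̄, (1, α))` of all representations of the doubled framed quiver. -/
abbrev Rep (α : ZMod m → ℕ) : Type := Coord α → ℂ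

/-- The matrix representing the arrow `a`, as an endomorphism of the total space. -/
def arr {α : ZMod m → ℕ} (p : Rep α) (a : Arrow m) : Matrix (Idx α) (Idx α) ℂ :=
  fun r s => if h : r.1 = a.tail ∧ s.1 = a.head then p ⟨(a, r, s), h⟩ else 0

/-- The idempotent of a vertex. -/
def idem (α : ZMod m → ℕ) (v : Option (ZMod m)) : Matrix (Idx α) (Idx α) ℂ :=
  Matrix.diagonal fun r => if r.1 = v then 1 else 0

/-- `X = ∑ i, X_i` as an endomorphism of `⨁ i, ℂ ^ (α i)`. -/
def matX {α : ZMod m → ℕ} (p : Rep α) : Matrix (IdxI α) (IdxI α) ℂ :=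
  fun r s => arr p (.x r.1) ⟨some r.1, r.2⟩ ⟨some s.1, s.2⟩

/-- `Y = ∑ i, Y_i` as an endomorphism of `⨁ i, ℂ ^ (α i)`. -/
def matY {α : ZMod m → ℕ} (p : Rep α) : Matrix (IdxI α) (IdxI α) ℂ :=
  fun r s => arr p (.y s.1) ⟨some r.1, r.2⟩ ⟨some s.1, s.2⟩

/-- The column `V`. -/
def matV {α : ZMod m → ℕ} (p : Rep α) : Matrix (Fin (α 0)) (Fin 1) ℂ :=
  fun r s => arr p .v ⟨some 0, r⟩ ⟨none, s⟩

/-- The row `W`. -/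
def matW {α : ZMod m → ℕ} (p : Rep α) : Matrix (Fin 1) (Fin (α 0)) ℂ :=
  fun r s => arr p .w ⟨none, r⟩ ⟨some 0, s⟩

variable [NeZero m]

/-- `Z = Y + X⁻¹`, to be used only where `X` is invertible. -/
def matZ {α : ZMod m → ℕ} (p : Rep α) : Matrix (IdxI α) (IdxI α) ℂ := matY p + (matX p)⁻¹

/-- The polynomial whose non-vanishing means that all `1 + a a*` are invertible, that is, which
cuts out the affine open subset `Rep(A, (1, α))` where `A` is the localised path algebra. -/
def detA (α : ZMod m → ℕ) (p : Rep α) : ℂ := ∏ a : Arrow m, (1 + arr p a * arr p a.star).det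

/-- The polynomial cutting out the locus in `Rep(A, (1, α))` where moreover `X` is invertible. -/
def detAX (α : ZMod m → ℕ) (p : Rep α) : ℂ := detA α p * (matX p).det

/-- The parameter at the framing vertex, `q_∞ = ∏ i, q_i ^ (-α_i)`. -/
def qInf (α : ZMod m → ℕ) (q : ZMod m → ℂˣ) : ℂ := ∏ i, (((q i)⁻¹ ^ α i : ℂˣ) : ℂ)

/-- `Rep(Λ^q̃, (1, α))`: representations of the multiplicative preprojective algebra of the framed
cyclic quiver. All `1 + a a*` are invertible and the moment map has the prescribed value at every
vertex. -/
def repLambda (α : ZMod m → ℕ) (q : ZMod m → ℂˣ) : Set (Rep α) :=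
  {p | (∀ a : Arrow m, IsUnit (1 + arr p a * arr p a.star)) ∧
    (∀ i : ZMod m, i ≠ 0 →
      idem α (some i) * (1 + arr p (.y (i - 1)) * arr p (.x (i - 1)))⁻¹
        * (1 + arr p (.x i) * arr p (.y i)) = (q i : ℂ) • idem α (some i)) ∧
    idem α (some 0) * (1 + arr p (.y (0 - 1)) * arr p (.x (0 - 1)))⁻¹
        * (1 + arr p (.x 0) * arr p (.y 0)) * (1 + arr p .v * arr p .w)
        = (q 0 : ℂ) • idem α (some 0) ∧
    idem α none * (1 + arr p .w * arr p .v)⁻¹ = qInf α q • idem α none}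

/-- The action of `∏ v, GL` (all vertices, including `∞`) by change of bases. -/
def act {α : ZMod m → ℕ} (g : ∀ v : Option (ZMod m), GL (Fin (dim α v)) ℂ) (p : Rep α) : Rep α :=
  fun c => (Matrix.blockDiagonal' (fun v => (g v : Matrix (Fin (dim α v)) (Fin (dim α v)) ℂ))
    * arr p c.1.1
    * Matrix.blockDiagonal' (fun v => (((g v)⁻¹ : GL (Fin (dim α v)) ℂ) :
        Matrix (Fin (dim α v)) (Fin (dim α v)) ℂ))) c.1.2.1 c.1.2.2

/-! ### Regular functions and the quotient -/

/-- `f` is a regular function on the principal open subset `{D ≠ 0}` of the affine space of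
representations (the values of `f` elsewhere are irrelevant). -/
def IsRegular {α : ZMod m → ℕ} (D f : Rep α → ℂ) : Prop :=
  ∃ (P : MvPolynomial (Coord α) ℂ) (n : ℕ), ∀ p, D p ≠ 0 → f p = MvPolynomial.eval p P / D p ^ n

/-- `f` is an invariant regular function on `{D ≠ 0}`. -/
def IsInvRegular {α : ZMod m → ℕ} (D f : Rep α → ℂ) : Prop :=
  IsRegular D f ∧ ∀ g p, D p ≠ 0 → f (act g p) = f p

/-- Two representations define the same point of the affine quotient by the (reductive) group iff
no invariant regular function separates them. (Invariant regular functions on the closed subset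
`Rep(Λ^q̃, (1, α))` are the restrictions of those on `Rep(A, (1, α))`.) -/
def quotSetoid (α : ZMod m → ℕ) (q : ZMod m → ℂˣ) : Setoid (repLambda α q) where
  r p p' := ∀ f, IsInvRegular (detA α) f → f p = f p'
  iseqv := ⟨fun _ _ _ => rfl, fun h f hf => (h f hf).symm,
    fun h h' f hf => (h f hf).trans (h' f hf)⟩

/-- The (points of the) multiplicative quiver variety
`M_{α, q} = Rep(Λ^q̃, (1, α)) // G(1, α)`. -/
def QuiverVariety (α : ZMod m → ℕ) (q : ZMod m → ℂˣ) : Type := Quotient (quotSetoid α q)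

/-- The point of the multiplicative quiver variety given by a representation. -/
def toVariety {α : ZMod m → ℕ} {q : ZMod m → ℂˣ} (p : repLambda α q) : QuiverVariety α q :=
  Quotient.mk (quotSetoid α q) p

/-! ### The quasi-Poisson bracket -/

/-- The matrix `𝒳(∂/∂a)` of (constant) vector fields: its `(r, s)` entry is the partial derivative
with respect to the `(s, r)` entry of the arrow `a`. -/
def partialA {α : ZMod m → ℕ} (a : Arrow m) (r s : Idx α) : Rep α :=
  if h : s.1 = a.tail ∧ r.1 = a.head then Pi.single ⟨(a, s, r), h⟩ 1 else 0

/-- The value at `p` of the matrix of vector fields `𝒳((1 + a* a) ∂/∂a)`. -/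
def kinetic {α : ZMod m → ℕ} (p : Rep α) (a : Arrow m) (r s : Idx α) : Rep α :=
  ∑ u, (1 + arr p a.star * arr p a) r u • partialA a u s

/-- The value at `p` of the matrix of vector fields `𝒳(F_a)`,
`F_a = (∂/∂a*) a* - a (∂/∂a)`. -/
def fusion {α : ZMod m → ℕ} (p : Rep α) (a : Arrow m) (r s : Idx α) : Rep α :=
  ∑ u, arr p a.star u s • partialA a.star r u - ∑ u, arr p a r u • partialA a u s

/-- For two double derivations `δ₁, δ₂` whose matrices of vector fields have the values `A, B` at
`p`, this is the bracket at `p` defined by the element `δ₁ δ₂`: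
`{f, g} = ∑ r s, (δ₁)_{rs}(f) (δ₂)_{sr}(g) - (δ₂)_{sr}(f) (δ₁)_{rs}(g)`. On matrix entries it is
`{a_ij, b_uv} = ⟪a, b⟫'_uj ⟪a, b⟫''_iv`, where `⟪a, b⟫` is the double bracket
`δ₂(b)' δ₁(a)'' ⊗ δ₁(a)' δ₂(b)'' - δ₁(b)' δ₂(a)'' ⊗ δ₂(a)' δ₁(b)''`. -/
def traceWedge {α : ZMod m → ℕ} (A B : Idx α → Idx α → Rep α) (f g : Rep α → ℂ) (p : Rep α) : ℂ :=
  ∑ r, ∑ s, (fderiv ℂ f p (A r s) * fderiv ℂ g p (B s r)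
    - fderiv ℂ f p (B s r) * fderiv ℂ g p (A r s))

/-- The quasi-Poisson bracket on the space of representations, given by the bivector
`P = ½ ∑_a ε(a) (1 + a* a) ∂/∂a ∂/∂a* - ½ ∑_{a < b, t(a) = t(b)} F_a F_b`. -/
def bracket {α : ZMod m → ℕ} (f g : Rep α → ℂ) (p : Rep α) : ℂ :=
  (1 / 2) * ∑ a : Arrow m, a.sign * traceWedge (kinetic p a) (partialA a.star) f g p
  - (1 / 2) * ∑ a : Arrow m, ∑ b : Arrow m,
      if a.tail = b.tail ∧ a.rank < b.rank then traceWedge (fusion p a) (fusion p b) f g p else 0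

/-! ### Hamiltonians and Hamiltonian flows -/

/-- `H_k = (1/k) tr Y^k`. -/
def hamH (α : ZMod m → ℕ) (k : ℕ) (p : Rep α) : ℂ := (1 / (k : ℂ)) * (matY p ^ k).trace

/-- `G_k = (1/k) tr Z^k`. -/
def hamG (α : ZMod m → ℕ) (k : ℕ) (p : Rep α) : ℂ := (1 / (k : ℂ)) * (matZ p ^ k).trace

/-- On the set `U` of (complex) times, the curve `c` stays in `{D ≠ 0}` and is an integral curve of
the Hamiltonian vector field `{H, -}`. -/
def IsIntegralCurveRep {α : ZMod m → ℕ} (D H : Rep α → ℂ) (c : ℂ → Rep α) (U : Set ℂ) : Prop :=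
  ∀ t ∈ U, D (c t) ≠ 0 ∧
    ∀ f, IsRegular D f → HasDerivAt (fun s => f (c s)) (bracket H f (c t)) t

/-- On the set `U` of (complex) times, the curve `c` in the quotient variety stays in the open
subset `{D ≠ 0}` and satisfies `d/dt f(c) = {H, f}(c)` for all regular functions `f` on this open
subset, that is, for all invariant regular functions `f`. Functions on the quotient are evaluated
through arbitrary representatives. -/
def IsIntegralCurveVar {α : ZMod m → ℕ} {q : ZMod m → ℂˣ} (D H : Rep α → ℂ)
    (c : ℂ → QuiverVariety α q) (U : Set ℂ) : Prop :=
  ∀ p : ℂ → repLambda α q, (∀ s, toVariety (p s) = c s) →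
    ∀ t ∈ U, D (p t) ≠ 0 ∧
      ∀ f, IsInvRegular D f → HasDerivAt (fun s => f (p s)) (bracket H f (p t)) t

/-- `γ` is the complete solution with initial position `p` of the Hamiltonian flow of `H` on the
open subset `{D ≠ 0}`: it stays in this open subset for all times, it is the integral curve of
`{H, -}` through `p` in the space of representations, and its image is the integral curve through
the class of `p` in the quotient variety; in both cases every other integral curve, defined on a
connected open set of times, agrees with it. -/
structure IsCompleteSolution {α : ZMod m → ℕ} {q : ZMod m → ℂˣ} (D H : Rep α → ℂ)
    (p : repLambda α q) (γ : ℂ → repLambda α q) : Prop where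
  zero : γ 0 = p
  mem : ∀ t, D (γ t) ≠ 0
  rep : IsIntegralCurveRep D H (fun t => (γ t : Rep α)) Set.univ
  rep_unique : ∀ (U : Set ℂ) (c : ℂ → Rep α), IsOpen U → IsPreconnected U → (0 : ℂ) ∈ U →
    c 0 = p → IsIntegralCurveRep D H c U → ∀ t ∈ U, c t = γ t
  var : IsIntegralCurveVar D H (fun t => toVariety (γ t)) Set.univ
  var_unique : ∀ (U : Set ℂ) (c : ℂ → QuiverVariety α q), IsOpen U → IsPreconnected U →
    (0 : ℂ) ∈ U → c 0 = toVariety p → IsIntegralCurveVar D H c U → ∀ t ∈ U, c t = toVariety (γ t)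

end Rep

/-! ### The function `z⁻¹ (exp (-t z ^ k) - 1)` of a matrix -/

section ExpQuot

variable {ι : Type*} [Fintype ι] [DecidableEq ι]

/-- The value at the matrix `B` of the entire function
`z⁻¹ (exp (-t z ^ k) - 1) = ∑ n, (-t) ^ (n + 1) / (n + 1)! z ^ (k (n + 1) - 1)`, for `k ≥ 1`. -/
def expQuot (k : ℕ) (t : ℂ) (B : Matrix ι ι ℂ) : Matrix ι ι ℂ :=
  ∑' n : ℕ, ((-t) ^ (n + 1) / ((n + 1)! : ℂ)) • B ^ (k * (n + 1) - 1)

open scoped Matrix.Norms.Operator in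
/-- Auxiliary form of `summable_expQuot`, for the topology of a matrix norm. -/
theorem summable_expQuot_aux {k : ℕ} (hk : 0 < k) (t : ℂ) (B : Matrix ι ι ℂ) :
    Summable fun n : ℕ => ((-t) ^ (n + 1) / ((n + 1)! : ℂ)) • B ^ (k * (n + 1) - 1) := by
  have h := (NormedSpace.norm_expSeries_summable' (𝕂 := ℂ) ((-t) • B ^ k)).mul_left ‖t‖
  have h2 : Summable fun n : ℕ => ((-t) ^ (n + 1) / ((n + 1)! : ℂ)) • (B ^ k) ^ n := by
    refine Summable.of_norm_bounded h fun n => ?_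
    have e : ((-t) ^ (n + 1) / ((n + 1)! : ℂ)) • (B ^ k) ^ n
        = ((-t) / ((n : ℂ) + 1)) • (((n ! : ℂ)⁻¹) • ((-t) • B ^ k) ^ n) := by
      rw [smul_pow, smul_smul, smul_smul]
      congr 1
      rw [Nat.factorial_succ]
      push_cast
      have h0 : (n : ℂ) + 1 ≠ 0 := by exact_mod_cast Nat.succ_ne_zero n
      have h1 : (n ! : ℂ) ≠ 0 := by exact_mod_cast Nat.factorial_ne_zero n
      field_simp
      ring
    rw [e, norm_smul]
    refine mul_le_mul_of_nonneg_right ?_ (norm_nonneg _)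
    rw [norm_div, norm_neg]
    refine div_le_self (norm_nonneg _) ?_
    have : ‖(n : ℂ) + 1‖ = (n : ℝ) + 1 := by
      exact_mod_cast Complex.norm_natCast (n + 1)
    rw [this]
    linarith [Nat.cast_nonneg (α := ℝ) n]
  have h3 := h2.mul_left (B ^ (k - 1))
  refine h3.congr fun n => ?_
  rw [mul_smul_comm, ← pow_mul, ← pow_add]
  congr 2
  rw [Nat.mul_add_one]
  omega

/-- The series defining `expQuot` converges. -/
theorem summable_expQuot {k : ℕ} (hk : 0 < k) (t : ℂ) (B : Matrix ι ι ℂ) :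
    Summable fun n : ℕ => ((-t) ^ (n + 1) / ((n + 1)! : ℂ)) • B ^ (k * (n + 1) - 1) :=
  summable_expQuot_aux hk t B

open scoped Matrix.Norms.Operator in
/-- Auxiliary form of `mul_expQuot`. -/
theorem mul_expQuot_aux {k : ℕ} (hk : 0 < k) (t : ℂ) (B : Matrix ι ι ℂ) :
    B * expQuot k t B = NormedSpace.exp ((-t) • B ^ k) - 1 := by
  have h := NormedSpace.exp_series_hasSum_exp' (𝕂 := ℂ) ((-t) • B ^ k)
  rw [← hasSum_nat_add_iff' 1] at h
  have h2 := (summable_expQuot_aux hk t B).hasSum.mul_left B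
  have e : (fun n : ℕ => B * (((-t) ^ (n + 1) / ((n + 1)! : ℂ)) • B ^ (k * (n + 1) - 1)))
      = fun n : ℕ => (((n + 1)! : ℂ)⁻¹) • ((-t) • B ^ k) ^ (n + 1) := by
    funext n
    rw [smul_pow, smul_smul, mul_smul_comm, ← pow_succ', ← pow_mul, div_eq_inv_mul]
    congr 2
    have : 0 < k * (n + 1) := Nat.mul_pos hk n.succ_pos
    omega
  rw [e] at h2
  have h3 := h2.unique h
  rw [Finset.sum_range_one, Nat.factorial_zero, Nat.cast_one, inv_one, pow_zero, one_smul] at h3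
  exact h3

/-- For all `B` one has `B * expQuot k t B = exp (-t B ^ k) - 1`. -/
theorem mul_expQuot {k : ℕ} (hk : 0 < k) (t : ℂ) (B : Matrix ι ι ℂ) :
    B * expQuot k t B = NormedSpace.exp ((-t) • B ^ k) - 1 :=
  mul_expQuot_aux hk t B

end ExpQuot

end

end CyclicQuiver

open CyclicQuiver

namespace CyclicQuiver

noncomputable section

set_option linter.unusedSectionVars false

/-! ### The quasi-Poisson bracket in terms of gradients and traces. -/

section Bracket

variable {m : ℕ} {α : ZMod m → ℕ}

/-! Let `A` and `B` be the gradients in `Y` and `X` of a Hamiltonian not involving `V`, `W`. Its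
infinitesimal invariance under base change reads `A Y - X B = Y A - B X`: at each vertex the values
`F_a(H)` add up to zero. Hence the fusion terms with `v` cancel, and the others can be regrouped
arrow by arrow, where they merge with the kinetic terms by cyclicity of the trace
(`trace_identity`). The outcome is `bracket_eq`: `{H, -}` is the vector field `X' = -A (1 + Y X)`,
`Y' = B (1 + X Y)`, `V' = W' = 0`.

For `H_k` one has `A = Y ^ (k - 1)` and `B = 0`, so `Y` is constant and `X` solves a linear
equation. For `G_k` one has `A = Z ^ (k - 1)` and `B = -X⁻¹ Z ^ (k - 1) X⁻¹`; since `1 + Y X = Z X`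
and `1 + X Y = X Z`, the field is `X' = -Z ^ k X`, `Y' = -X⁻¹ Z ^ k`, and `Z` is constant. In both
cases `1 + X Y` and `1 + Y X` get multiplied on the left by the same exponential `E(t)`. It is
block-diagonal because `m ∣ k`, so it cancels from the relations at the vertices of the cycle
(`setXY_mem_repLambda`).

On the quotient only invariant functions can be differentiated, so uniqueness is not taken from ODE
theory. The Hamiltonian field is regular and equivariant, so `{H, -}` maps (invariant) regular
functions to such functions. All derivatives at time `0` of such a function along an integral curve
are therefore determined by the initial point, and the identity theorem for holomorphic functions
concludes (`eq_of_forall_hasDerivAt`). -/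

theorem sum_arrow [NeZero m] {M : Type*} [AddCommMonoid M] (F : Arrow m → M) :
    ∑ a, F a = (∑ i, F (.x i)) + (∑ i, F (.y i)) + (F .v + F .w) := by
  rw [← (arrowEquiv m).sum_comp, Fintype.sum_sum_type, Fintype.sum_sum_type, Fintype.sum_bool,
    ← add_assoc]
  rfl

/-- The gradient of a linear functional with respect to the arrow `a`, as a matrix with rows at the
head and columns at the tail of `a`. -/
def grad (l : Rep α →L[ℂ] ℂ) (a : Arrow m) : Matrix (Idx α) (Idx α) ℂ :=
  Matrix.of fun r s => l (partialA a r s)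

theorem apply_eq_sum_trace_grad [NeZero m] (l : Rep α →L[ℂ] ℂ) (v : Rep α) :
    l v = ∑ a, (arr v a * grad l a).trace := by
  have h1 : l v = ∑ c : Coord α, v c * l (Pi.single c 1) := by
    conv_lhs => rw [pi_eq_sum_univ' v]
    simp [map_sum]
  rw [h1]
  have h2 : ∀ c : Coord α, v c * l (Pi.single c 1)
      = arr v c.1.1 c.1.2.1 c.1.2.2 * l (partialA c.1.1 c.1.2.2 c.1.2.1) := by
    rintro ⟨⟨a, r, s⟩, h⟩
    have h' : r.1 = a.tail ∧ s.1 = a.head := h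
    simp only [arr, partialA]
    rw [dif_pos h', dif_pos h']
  rw [Finset.sum_congr rfl fun c _ => h2 c]
  -- Triples that are not coordinates may be added to the sum, since `arr v` vanishes on them.
  have h3 : ∑ c : Coord α, arr v c.1.1 c.1.2.1 c.1.2.2 * l (partialA c.1.1 c.1.2.2 c.1.2.1)
      = ∑ c : Arrow m × Idx α × Idx α, arr v c.1 c.2.1 c.2.2 * l (partialA c.1 c.2.2 c.2.1) := by
    refine Fintype.sum_of_injective Subtype.val Subtype.val_injective _ _ (fun c hc => ?_)
      fun c => rfl
    have hc' : ¬ (c.2.1.1 = c.1.tail ∧ c.2.2.1 = c.1.head) := fun h => hc ⟨⟨c, h⟩, rfl⟩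
    rw [arr, dif_neg hc', zero_mul]
  rw [h3, Fintype.sum_prod_type]
  refine Finset.sum_congr rfl fun a _ => ?_
  rw [Fintype.sum_prod_type]
  simp [Matrix.trace, Matrix.mul_apply, grad]

theorem apply_kinetic [NeZero m] (l : Rep α →L[ℂ] ℂ) (p : Rep α) (a : Arrow m) (r s : Idx α) :
    l (kinetic p a r s) = ((1 + arr p a.star * arr p a) * grad l a) r s := by
  simp [kinetic, Matrix.mul_apply, grad]

theorem apply_fusion [NeZero m] (l : Rep α →L[ℂ] ℂ) (p : Rep α) (a : Arrow m) (r s : Idx α) :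
    l (fusion p a r s) = (grad l a.star * arr p a.star - arr p a * grad l a) r s := by
  simp [fusion, Matrix.mul_apply, grad, mul_comm]

theorem traceWedge_eq [NeZero m] (A B : Idx α → Idx α → Rep α) (f g : Rep α → ℂ) (p : Rep α)
    {Af Bf Ag Bg : Matrix (Idx α) (Idx α) ℂ} (hAf : ∀ r s, fderiv ℂ f p (A r s) = Af r s)
    (hBf : ∀ r s, fderiv ℂ f p (B r s) = Bf r s) (hAg : ∀ r s, fderiv ℂ g p (A r s) = Ag r s)
    (hBg : ∀ r s, fderiv ℂ g p (B r s) = Bg r s) :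
    traceWedge A B f g p = (Af * Bg).trace - (Bf * Ag).trace := by
  simp only [traceWedge, hAf, hBf, hAg, hBg, Matrix.trace, Matrix.diag, Matrix.mul_apply,
    Finset.sum_sub_distrib]
  congr 1
  exact Finset.sum_comm

/-- The contribution of one pair `x_i`, `y_i` to twice the bracket: the first two lines are the
kinetic terms and the third collects the regrouped fusion terms. Here `A, B` are gradients of the
Hamiltonian and `S, T` those of the other function. Only cyclicity of the trace is used. -/
theorem trace_identity {ι : Type*} [Fintype ι] [DecidableEq ι] (x y A B S T : Matrix ι ι ℂ) :
    ((1 + y * x) * B * T).trace - (A * ((1 + y * x) * S)).trace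
      - (((1 + x * y) * A * S).trace - (B * ((1 + x * y) * T)).trace)
      + ((A * y - x * B) * (T * y - x * S)).trace + ((y * A - B * x) * (S * x - y * T)).trace
    = 2 * ((-(A * (1 + y * x)) * S).trace + (B * (1 + x * y) * T).trace) := by
  have c1 : (x * B * T * y).trace = (y * x * B * T).trace := by
    rw [Matrix.trace_mul_comm]; simp only [mul_assoc]
  have c2 : (y * A * S * x).trace = (x * y * A * S).trace := by
    rw [Matrix.trace_mul_comm]; simp only [mul_assoc]
  have c3 : (A * y * T * y).trace = (y * A * y * T).trace := by
    rw [Matrix.trace_mul_comm]; simp only [mul_assoc]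
  have c4 : (B * x * S * x).trace = (x * B * x * S).trace := by
    rw [Matrix.trace_mul_comm]; simp only [mul_assoc]
  simp only [mul_add, add_mul, mul_sub, sub_mul, Matrix.trace_add, Matrix.trace_sub, one_mul,
    mul_one, Matrix.neg_mul, Matrix.trace_neg, neg_add, ← mul_assoc, c1, c2, c3, c4]
  ring

/-- The arrows `y i` and `x (i + 1)` share the tail `i + 1`. At `0` the arrow `v` comes after both
`y (-1)` and `x 0`, which gives two extra pairs; `w` is alone at `∞`. -/
theorem sum_fusion_pairs [NeZero m] {M : Type*} [AddCommMonoid M] (F : Arrow m → Arrow m → M) :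
    (∑ a : Arrow m, ∑ b : Arrow m, if a.tail = b.tail ∧ a.rank < b.rank then F a b else 0)
      = (∑ i, F (.y i) (.x (i + 1))) + (F (.y (0 - 1)) .v + F (.x 0) .v) := by
  simp only [sum_arrow, Arrow.tail, Arrow.rank]
  have e : ∀ i : ZMod m, i + 1 = 0 ↔ i = 0 - 1 := fun i => eq_sub_iff_add_eq.symm
  simp [Finset.sum_add_distrib, e, add_comm, add_assoc]

/-- The hypothesis `hxy` says that the values on `H` of `F_a` for `a = x (i + 1)` and `a = y i` are
opposite. This trades each mixed fusion term for one belonging to a single pair `x i`, `y i`. -/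
theorem bracket_eq_of_grad [NeZero m] {H f : Rep α → ℂ} {p v : Rep α}
    (hv : grad (fderiv ℂ H p) .v = 0) (hw : grad (fderiv ℂ H p) .w = 0)
    (hxy : ∀ i, grad (fderiv ℂ H p) (.y (i + 1)) * arr p (.y (i + 1))
        - arr p (.x (i + 1)) * grad (fderiv ℂ H p) (.x (i + 1))
      = arr p (.y i) * grad (fderiv ℂ H p) (.y i) - grad (fderiv ℂ H p) (.x i) * arr p (.x i))
    (vx : ∀ i, arr v (.x i)
      = -(grad (fderiv ℂ H p) (.y i) * (1 + arr p (.y i) * arr p (.x i))))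
    (vy : ∀ i, arr v (.y i)
      = grad (fderiv ℂ H p) (.x i) * (1 + arr p (.x i) * arr p (.y i)))
    (vv : arr v .v = 0) (vw : arr v .w = 0) :
    bracket H f p = fderiv ℂ f p v := by
  have hk : ∀ a, traceWedge (kinetic p a) (partialA a.star) H f p
      = ((1 + arr p a.star * arr p a) * grad (fderiv ℂ H p) a * grad (fderiv ℂ f p) a.star).trace
        - (grad (fderiv ℂ H p) a.star
          * ((1 + arr p a.star * arr p a) * grad (fderiv ℂ f p) a)).trace := fun a =>
    traceWedge_eq _ _ _ _ _ (fun r s => apply_kinetic _ p a r s) (fun r s => rfl)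
      (fun r s => apply_kinetic _ p a r s) (fun r s => rfl)
  have hf : ∀ a b, traceWedge (fusion p a) (fusion p b) H f p = _ := fun a b =>
    traceWedge_eq _ _ _ _ _ (fun r s => apply_fusion _ p a r s) (fun r s => apply_fusion _ p b r s)
      (fun r s => apply_fusion _ p a r s) (fun r s => apply_fusion _ p b r s)
  rw [apply_eq_sum_trace_grad, sum_arrow, vv, vw, bracket, sum_fusion_pairs, sum_arrow]
  simp only [hk, hf]
  simp only [Arrow.star, Arrow.sign, hv, hw, vx, vy, mul_zero, zero_mul, sub_zero, zero_sub,
    Matrix.trace_zero, add_zero, one_mul]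
  set A := fun i => grad (fderiv ℂ H p) (.y i)
  set B := fun i => grad (fderiv ℂ H p) (.x i)
  set S := fun i => grad (fderiv ℂ f p) (.x i)
  set T := fun i => grad (fderiv ℂ f p) (.y i)
  set x := fun i => arr p (.x i)
  set y := fun i => arr p (.y i)
  have e1 : ∑ i, ((B i * x i - y i * A i) * (T (i + 1) * y (i + 1) - x (i + 1) * S (i + 1))).trace
      = - ∑ i, ((A i * y i - x i * B i) * (T i * y i - x i * S i)).trace := by
    rw [← Finset.sum_neg_distrib, ← Equiv.sum_comp (Equiv.addRight (1 : ZMod m))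
      (fun i => -((A i * y i - x i * B i) * (T i * y i - x i * S i)).trace)]
    refine Finset.sum_congr rfl fun i _ => ?_
    rw [Equiv.coe_addRight, ← Matrix.trace_neg, ← neg_mul]
    rw [show A (i + 1) * y (i + 1) - x (i + 1) * B (i + 1) = y i * A i - B i * x i from hxy i,
      neg_sub]
  have e2 : ∑ i, ((A (i + 1) * y (i + 1) - x (i + 1) * B (i + 1)) * (S i * x i - y i * T i)).trace
      = ∑ i, ((y i * A i - B i * x i) * (S i * x i - y i * T i)).trace :=
    Finset.sum_congr rfl fun i _ => by
      rw [show A (i + 1) * y (i + 1) - x (i + 1) * B (i + 1) = y i * A i - B i * x i from hxy i]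
  -- The two fusion terms paired with `v` cancel each other by invariance at the vertex `0`.
  have e3 : A 0 * y 0 - x 0 * B 0 = -(B (-1) * x (-1) - y (-1) * A (-1)) := by
    have := hxy (-1)
    rw [neg_add_cancel] at this
    rw [neg_sub]
    exact this
  have e4 := Finset.sum_congr rfl fun i (_ : i ∈ (Finset.univ : Finset (ZMod m))) =>
    trace_identity (x i) (y i) (A i) (B i) (S i) (T i)
  simp only [Finset.sum_sub_distrib, Finset.sum_add_distrib, ← Finset.mul_sum] at e4
  simp only [Finset.sum_sub_distrib, ← Finset.mul_sum]
  rw [e1, e2, e3, neg_mul (B (-1) * x (-1) - y (-1) * A (-1)), Matrix.trace_neg]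
  simp only [A, B, S, T, x, y] at e4 ⊢
  linear_combination (1 / 2) * e4
end Bracket

/-! ### Block matrices graded by `ZMod m`. -/

section Homogeneous

variable {m : ℕ} {α : ZMod m → ℕ}

/-- The idempotent of a vertex `i ≠ ∞` on `⨁ i, ℂ ^ (α i)`. -/
def proj (α : ZMod m → ℕ) (i : ZMod m) : Matrix (IdxI α) (IdxI α) ℂ :=
  Matrix.diagonal fun r => if r.1 = i then 1 else 0

/-- A matrix which maps rows at the vertex `i` to columns at the vertex `i + d`. -/
def IsHomogeneous (d : ZMod m) (M : Matrix (IdxI α) (IdxI α) ℂ) : Prop :=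
  ∀ r s, s.1 ≠ r.1 + d → M r s = 0

variable [NeZero m]

theorem proj_mul_apply (i : ZMod m) (M : Matrix (IdxI α) (IdxI α) ℂ) (r s : IdxI α) :
    (proj α i * M) r s = if r.1 = i then M r s else 0 := by
  simp [proj, Matrix.diagonal_mul]

theorem mul_proj_apply (i : ZMod m) (M : Matrix (IdxI α) (IdxI α) ℂ) (r s : IdxI α) :
    (M * proj α i) r s = if s.1 = i then M r s else 0 := by
  simp [proj, Matrix.mul_diagonal]

theorem proj_mul_proj (i : ZMod m) : proj α i * proj α i = proj α i := by
  ext r s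
  rw [proj_mul_apply]
  by_cases h : r.1 = i
  · rw [if_pos h]
  · rw [if_neg h]
    by_cases h' : r = s <;> simp [proj, Matrix.diagonal, h']
    exact fun h2 => absurd (h' ▸ h2) h

/-- Being homogeneous is a commutation rule with the vertex idempotents, which reduces products and
inverses to algebra without entries. -/
theorem isHomogeneous_iff {d : ZMod m} {M : Matrix (IdxI α) (IdxI α) ℂ} :
    IsHomogeneous d M ↔ ∀ i, proj α i * M = M * proj α (i + d) := by
  constructor
  · intro h i
    ext r s
    rw [proj_mul_apply, mul_proj_apply]
    by_cases h' : s.1 = r.1 + d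
    · simp [h']
    · simp [h r s h']
  · intro h r s hs
    have := congrFun (congrFun (h r.1) r) s
    rwa [proj_mul_apply, mul_proj_apply, if_pos rfl, if_neg hs] at this

namespace IsHomogeneous

variable {d e : ZMod m} {M N : Matrix (IdxI α) (IdxI α) ℂ}

theorem proj_mul (h : IsHomogeneous d M) (i : ZMod m) : proj α i * M = M * proj α (i + d) :=
  isHomogeneous_iff.1 h i

theorem one : IsHomogeneous 0 (1 : Matrix (IdxI α) (IdxI α) ℂ) :=
  isHomogeneous_iff.2 fun i => by simp

theorem add (hM : IsHomogeneous d M) (hN : IsHomogeneous d N) : IsHomogeneous d (M + N) :=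
  fun r s h => by simp [hM r s h, hN r s h]

theorem neg (hM : IsHomogeneous d M) : IsHomogeneous d (-M) :=
  fun r s h => by simp [hM r s h]

theorem smul (c : ℂ) (hM : IsHomogeneous d M) : IsHomogeneous d (c • M) :=
  fun r s h => by simp [hM r s h]

theorem mul (hM : IsHomogeneous d M) (hN : IsHomogeneous e N) : IsHomogeneous (d + e) (M * N) :=
  isHomogeneous_iff.2 fun i => by
    rw [← mul_assoc, hM.proj_mul, mul_assoc, hN.proj_mul, ← mul_assoc, add_assoc]

theorem pow (hM : IsHomogeneous d M) (n : ℕ) : IsHomogeneous ((n : ZMod m) * d) (M ^ n) := by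
  induction n with
  | zero => simpa using one
  | succ n ih =>
    rw [pow_succ]
    convert ih.mul hM using 1
    push_cast
    ring

theorem inv (hM : IsHomogeneous d M) (hu : IsUnit M) : IsHomogeneous (-d) M⁻¹ :=
  isHomogeneous_iff.2 fun i => by
    have hd := (Matrix.isUnit_iff_isUnit_det M).1 hu
    have h := hM.proj_mul (i + -d)
    rw [neg_add_cancel_right] at h
    calc proj α i * M⁻¹ = M⁻¹ * (M * proj α i) * M⁻¹ := by
          rw [← mul_assoc, Matrix.nonsing_inv_mul M hd, one_mul]
      _ = M⁻¹ * proj α (i + -d) := by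
          rw [← h, ← mul_assoc, mul_assoc _ M, Matrix.mul_nonsing_inv M hd, mul_one]

theorem of_hasSum {ι : Type*} {F : ι → Matrix (IdxI α) (IdxI α) ℂ} (hF : HasSum F M)
    (h : ∀ n, IsHomogeneous d (F n)) : IsHomogeneous d M := fun r s hs => by
  have h1 : HasSum (fun n => F n r s) (M r s) := by
    have := Pi.hasSum.1 (Pi.hasSum.1 hF r) s
    exact this
  have h2 : (fun n => F n r s) = fun _ => 0 := funext fun n => h n r s hs
  rw [h2] at h1
  exact h1.unique hasSum_zero

open scoped Matrix.Norms.Operator in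
theorem exp (hM : IsHomogeneous 0 M) : IsHomogeneous 0 (NormedSpace.exp M) :=
  of_hasSum (NormedSpace.exp_series_hasSum_exp' (𝕂 := ℂ) M) fun n => by
    simpa using (hM.pow n).smul ((n ! : ℂ)⁻¹)

end IsHomogeneous

end Homogeneous

/-! ### Passage between arrows and the endomorphisms `X`, `Y`. -/

section Extend

variable {m : ℕ} {α : ZMod m → ℕ}

/-- Extension of a matrix by zero to the framing vertex. -/
def extend (M : Matrix (IdxI α) (IdxI α) ℂ) : Matrix (Idx α) (Idx α) ℂ :=
  fun r s => match r, s with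
    | ⟨some i, a⟩, ⟨some j, b⟩ => M ⟨i, a⟩ ⟨j, b⟩
    | _, _ => 0

theorem extend_add (M N : Matrix (IdxI α) (IdxI α) ℂ) :
    extend (M + N) = extend M + extend N := by
  ext ⟨_ | i, a⟩ ⟨_ | j, b⟩ <;> simp [extend]

theorem extend_neg (M : Matrix (IdxI α) (IdxI α) ℂ) : extend (-M) = -extend M := by
  ext ⟨_ | i, a⟩ ⟨_ | j, b⟩ <;> simp [extend]

theorem extend_sub (M N : Matrix (IdxI α) (IdxI α) ℂ) :
    extend (M - N) = extend M - extend N := by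
  rw [sub_eq_add_neg, extend_add, extend_neg, ← sub_eq_add_neg]

theorem matX_apply (p : Rep α) (i j : ZMod m) (a b) :
    matX p ⟨i, a⟩ ⟨j, b⟩ = arr p (.x i) ⟨some i, a⟩ ⟨some j, b⟩ := rfl

theorem matY_apply (p : Rep α) (i j : ZMod m) (a b) :
    matY p ⟨i, a⟩ ⟨j, b⟩ = arr p (.y j) ⟨some i, a⟩ ⟨some j, b⟩ := rfl

theorem arr_eq_zero (p : Rep α) {a : Arrow m} {r s : Idx α} (h : ¬ (r.1 = a.tail ∧ s.1 = a.head)) :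
    arr p a r s = 0 := dif_neg h

theorem isHomogeneous_matX (p : Rep α) : IsHomogeneous 1 (matX p) := fun _ _ h =>
  arr_eq_zero p fun h' => h (Option.some_injective _ h'.2)

theorem isHomogeneous_matY (p : Rep α) : IsHomogeneous (-1) (matY p) := fun _ _ h =>
  arr_eq_zero p fun h' => h (by rw [Option.some_injective _ h'.1]; simp)

variable [NeZero m]

theorem extend_mul (M N : Matrix (IdxI α) (IdxI α) ℂ) : extend (M * N) = extend M * extend N := by
  ext ⟨_ | i, a⟩ ⟨_ | j, b⟩ <;>
    simp [extend, Matrix.mul_apply, Fintype.sum_sigma, Fintype.sum_option]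

theorem idem_mul_extend (i : ZMod m) (M : Matrix (IdxI α) (IdxI α) ℂ) :
    idem α (some i) * extend M = extend (proj α i * M) := by
  ext ⟨_ | i, a⟩ ⟨_ | j, b⟩ <;> simp [extend, idem, Matrix.diagonal_mul, proj]

theorem extend_mul_idem (i : ZMod m) (M : Matrix (IdxI α) (IdxI α) ℂ) :
    extend M * idem α (some i) = extend (M * proj α i) := by
  ext ⟨_ | i, a⟩ ⟨_ | j, b⟩ <;> simp [extend, idem, Matrix.mul_diagonal, proj]

theorem extend_proj (i : ZMod m) : extend (proj α i) = idem α (some i) := by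
  ext ⟨_ | i, a⟩ ⟨_ | j, b⟩
  · simp [extend, idem, Matrix.diagonal_apply]
  · simp [extend, idem]
  · simp [extend, idem]
  · by_cases h : i = j
    · subst h
      simp [extend, idem, Matrix.diagonal_apply, proj]
    · simp [extend, idem, proj, h]

theorem arr_x (p : Rep α) (i : ZMod m) : arr p (.x i) = extend (proj α i * matX p) := by
  ext ⟨_ | j, a⟩ ⟨_ | l, b⟩
  · exact arr_eq_zero p (by simp [Arrow.tail])
  · exact arr_eq_zero p (by simp [Arrow.tail])
  · exact arr_eq_zero p (by simp [Arrow.head])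
  · simp only [extend, proj_mul_apply]
    split_ifs with h
    · subst h; rfl
    · exact arr_eq_zero p fun h' => h (Option.some_injective _ h'.1)

theorem arr_y (p : Rep α) (i : ZMod m) : arr p (.y i) = extend (matY p * proj α i) := by
  ext ⟨_ | j, a⟩ ⟨_ | l, b⟩
  · exact arr_eq_zero p (by simp [Arrow.tail])
  · exact arr_eq_zero p (by simp [Arrow.tail])
  · exact arr_eq_zero p (by simp [Arrow.head])
  · simp only [extend, mul_proj_apply]
    split_ifs with h
    · subst h; rfl
    · exact arr_eq_zero p fun h' => h (Option.some_injective _ h'.2)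

/-- The representation obtained from `p` by replacing the endomorphisms `X` and `Y`. -/
def setXY (p : Rep α) (X Y : Matrix (IdxI α) (IdxI α) ℂ) : Rep α := fun c =>
  match c.1.1 with
  | .x _ => extend X c.1.2.1 c.1.2.2
  | .y _ => extend Y c.1.2.1 c.1.2.2
  | .v => p c
  | .w => p c

/-- `setXY` reads only the entries that fit an arrow; homogeneity ensures that nothing of `X` is
lost. -/
theorem matX_setXY (p : Rep α) {X Y : Matrix (IdxI α) (IdxI α) ℂ} (hX : IsHomogeneous 1 X) :
    matX (setXY p X Y) = X := by
  ext r s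
  by_cases h : s.1 = r.1 + 1
  · simp only [matX, arr]
    rw [dif_pos ⟨rfl, congrArg some h⟩]
    rfl
  · rw [hX r s h, isHomogeneous_matX _ r s h]

theorem matY_setXY (p : Rep α) {X Y : Matrix (IdxI α) (IdxI α) ℂ} (hY : IsHomogeneous (-1) Y) :
    matY (setXY p X Y) = Y := by
  ext r s
  by_cases h : s.1 = r.1 + -1
  · simp only [matY, arr]
    rw [dif_pos ⟨by simp [Arrow.tail, h], rfl⟩]
    rfl
  · rw [hY r s h, isHomogeneous_matY _ r s h]

theorem arr_setXY_v (p : Rep α) (X Y : Matrix (IdxI α) (IdxI α) ℂ) :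
    arr (setXY p X Y) .v = arr p .v := rfl

theorem arr_setXY_w (p : Rep α) (X Y : Matrix (IdxI α) (IdxI α) ℂ) :
    arr (setXY p X Y) .w = arr p .w := rfl

theorem rep_ext {p q : Rep α} (h : ∀ a, arr p a = arr q a) : p = q := by
  funext ⟨⟨a, r, s⟩, hc⟩
  have h' : r.1 = a.tail ∧ s.1 = a.head := hc
  have := congrFun (congrFun (h a) r) s
  simpa only [arr, dif_pos h'] using this

theorem setXY_self (p : Rep α) : setXY p (matX p) (matY p) = p := by
  refine rep_ext fun a => ?_
  cases a with
  | x i => rw [arr_x, arr_x, matX_setXY p (isHomogeneous_matX p)]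
  | y i => rw [arr_y, arr_y, matY_setXY p (isHomogeneous_matY p)]
  | v => rfl
  | w => rfl

end Extend

/-! ### The Hamiltonian vector field of a function of `X` and `Y`. -/

section GradXY

variable {m : ℕ} {α : ZMod m → ℕ} {A B : Matrix (IdxI α) (IdxI α) ℂ}

theorem arr_partialA (a b : Arrow m) (r s r' s' : Idx α) :
    arr (partialA a r s) b r' s'
      = if (b = a ∧ r' = s ∧ s' = r) ∧ s.1 = a.tail ∧ r.1 = a.head then 1 else 0 := by
  by_cases h : s.1 = a.tail ∧ r.1 = a.head
  · by_cases h' : b = a ∧ r' = s ∧ s' = r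
    · obtain ⟨rfl, rfl, rfl⟩ := h'
      simp [arr, partialA, h]
    · rw [if_neg fun h2 => h' h2.1, arr, partialA, dif_pos h]
      split_ifs
      · rw [Pi.single_apply, if_neg]
        intro h2
        have := congrArg Subtype.val h2
        simp only [Prod.mk.injEq] at this
        exact h' this
      · rfl
  · rw [if_neg fun h2 => h h2.2, arr, partialA, dif_neg h]
    simp

theorem matY_partialA_of_ne {a : Arrow m} (h : ∀ i, a ≠ .y i) (r s : Idx α) :
    matY (partialA a r s) = 0 := by
  ext u v
  rw [matY, arr_partialA, if_neg fun h' => h _ h'.1.1.symm]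
  rfl

theorem matX_partialA_of_ne {a : Arrow m} (h : ∀ i, a ≠ .x i) (r s : Idx α) :
    matX (partialA a r s) = 0 := by
  ext u v
  rw [matX, arr_partialA, if_neg fun h' => h _ h'.1.1.symm]
  rfl

variable [NeZero m]

/-- A block of `A` is the gradient of `v ↦ tr (A * matY v)` along `y i`. The degree of `A` is needed
because `partialA` vanishes at positions that do not fit the arrow. -/
theorem trace_mul_matY_partialA (i : ZMod m) (r s : Idx α) (hA : IsHomogeneous 1 A) :
    (A * matY (partialA (.y i) r s)).trace = extend (proj α i * A) r s := by
  simp only [Matrix.trace, Matrix.diag, Matrix.mul_apply, matY, arr_partialA]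
  obtain ⟨_ | j, a⟩ := r <;> obtain ⟨_ | l, b⟩ := s
  · simp [extend]
  · simp [extend]
  · simp [extend]
  · have e : ∀ u v : IdxI α, ((((Arrow.y u.1 : Arrow m) = .y i
        ∧ (⟨some v.1, v.2⟩ : Idx α) = ⟨some l, b⟩
        ∧ (⟨some u.1, u.2⟩ : Idx α) = ⟨some j, a⟩) ∧ (some l : Option (ZMod m)) = Arrow.tail (.y i)
        ∧ (some j : Option (ZMod m)) = Arrow.head (.y i))
        ↔ (v = ⟨l, b⟩ ∧ u = ⟨j, a⟩ ∧ l = i + 1 ∧ j = i)) := by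
      rintro ⟨u, u'⟩ ⟨v, v'⟩
      simp only [Arrow.tail, Arrow.head, Arrow.y.injEq, Sigma.mk.injEq, Option.some.injEq]
      constructor
      · rintro ⟨⟨-, h2, h3⟩, h4⟩
        exact ⟨h2, h3, h4⟩
      · rintro ⟨h2, h3, h4⟩
        exact ⟨⟨h3.1.trans h4.2, h2, h3⟩, h4⟩
    simp only [e, extend, proj_mul_apply]
    by_cases h : j = i
    · subst h
      by_cases hl : l = j + 1
      · simp [hl, ite_and]
      · rw [if_pos rfl, hA _ _ hl]
        simp [hl]
    · simp [h]

theorem trace_mul_matX_partialA (i : ZMod m) (r s : Idx α) (hB : IsHomogeneous (-1) B) :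
    (B * matX (partialA (.x i) r s)).trace = extend (B * proj α i) r s := by
  simp only [Matrix.trace, Matrix.diag, Matrix.mul_apply, matX, arr_partialA]
  obtain ⟨_ | j, a⟩ := r <;> obtain ⟨_ | l, b⟩ := s
  · simp [extend]
  · simp [extend]
  · simp [extend]
  · have e : ∀ u v : IdxI α, ((((Arrow.x v.1 : Arrow m) = .x i
        ∧ (⟨some v.1, v.2⟩ : Idx α) = ⟨some l, b⟩
        ∧ (⟨some u.1, u.2⟩ : Idx α) = ⟨some j, a⟩) ∧ (some l : Option (ZMod m)) = Arrow.tail (.x i)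
        ∧ (some j : Option (ZMod m)) = Arrow.head (.x i))
        ↔ (v = ⟨l, b⟩ ∧ u = ⟨j, a⟩ ∧ l = i ∧ j = i + 1)) := by
      rintro ⟨u, u'⟩ ⟨v, v'⟩
      simp only [Arrow.tail, Arrow.head, Arrow.x.injEq, Sigma.mk.injEq, Option.some.injEq]
      constructor
      · rintro ⟨⟨-, h2, h3⟩, h4⟩
        exact ⟨h2, h3, h4⟩
      · rintro ⟨h2, h3, h4⟩
        exact ⟨⟨h2.1.trans h4.1, h2, h3⟩, h4⟩
    simp only [e, extend, mul_proj_apply]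
    by_cases h : l = i
    · subst h
      by_cases hl : j = l + 1
      · simp [hl, ite_and]
      · rw [if_pos rfl, hB _ _ fun h2 : l = j + -1 => hl (by rw [h2]; ring)]
        simp [hl]
    · simp [h]

/-- Here `A` and `B` are the gradients of `H` in `Y` and `X`, and `hAB` is the infinitesimal
invariance of `H` under base change. The representation `setXY 0 _ _` is a tangent vector with
vanishing `V` and `W` components. -/
theorem bracket_eq {H f : Rep α → ℂ} {p : Rep α}
    (hH : ∀ v, fderiv ℂ H p v = (A * matY v).trace + (B * matX v).trace)
    (hA : IsHomogeneous 1 A) (hB : IsHomogeneous (-1) B)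
    (hAB : A * matY p - matX p * B = matY p * A - B * matX p) :
    bracket H f p = fderiv ℂ f p
      (setXY 0 (-(A * (1 + matY p * matX p))) (B * (1 + matX p * matY p))) := by
  have gx : ∀ i, grad (fderiv ℂ H p) (.x i) = extend (B * proj α i) := fun i => by
    ext r s
    rw [grad, Matrix.of_apply, hH, matY_partialA_of_ne (by simp), ← trace_mul_matX_partialA i r s hB]
    simp
  have gy : ∀ i, grad (fderiv ℂ H p) (.y i) = extend (proj α i * A) := fun i => by
    ext r s
    rw [grad, Matrix.of_apply, hH, matX_partialA_of_ne (by simp), ← trace_mul_matY_partialA i r s hA]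
    simp
  have gvw : ∀ a, (∀ i, a ≠ .x i) → (∀ i, a ≠ .y i) → grad (fderiv ℂ H p) a = 0 := by
    intro a hx hy
    ext r s
    rw [grad, Matrix.of_apply, hH, matX_partialA_of_ne hx, matY_partialA_of_ne hy]
    simp
  have hX := isHomogeneous_matX p
  have hY := isHomogeneous_matY p
  have pX := fun i => hX.proj_mul i
  have pY : ∀ i, proj α (i + 1) * matY p = matY p * proj α i := fun i => by
    rw [hY.proj_mul, add_neg_cancel_right]
  have pA := fun i => hA.proj_mul i
  have pB : ∀ i, proj α (i + 1) * B = B * proj α i := fun i => by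
    rw [hB.proj_mul, add_neg_cancel_right]
  have hYX : IsHomogeneous 0 (1 + matY p * matX p) :=
    IsHomogeneous.one.add (by simpa using hY.mul hX)
  have hXY : IsHomogeneous 0 (1 + matX p * matY p) :=
    IsHomogeneous.one.add (by simpa using hX.mul hY)
  have hpp := proj_mul_proj (α := α)
  refine bracket_eq_of_grad (gvw _ (by simp) (by simp)) (gvw _ (by simp) (by simp)) (fun i => ?_)
    (fun i => ?_) (fun i => ?_) (by ext; simp [arr, setXY]) (by ext; simp [arr, setXY])
  · simp only [gx, gy, arr_x, arr_y, ← extend_mul, ← extend_sub]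
    congr 1
    -- Cutting `hAB` down to the vertex `i + 1` on both sides; the idempotents, moved through the
    -- homogeneous factors, split each product into single arrows.
    calc proj α (i + 1) * A * (matY p * proj α (i + 1))
          - proj α (i + 1) * matX p * (B * proj α (i + 1))
        = proj α (i + 1) * (A * matY p - matX p * B) * proj α (i + 1) := by noncomm_ring
      _ = proj α (i + 1) * matY p * A * proj α (i + 1)
          - proj α (i + 1) * B * matX p * proj α (i + 1) := by rw [hAB]; noncomm_ring
      _ = matY p * (proj α i * (A * proj α (i + 1)))
          - B * (proj α i * (matX p * proj α (i + 1))) := by rw [pY, pB]; noncomm_ring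
      _ = matY p * proj α i * (proj α i * A) - B * proj α i * (proj α i * matX p) := by
        rw [← pA, ← pX]; noncomm_ring
  · rw [arr_x, matX_setXY _ (by simpa using (hA.mul hYX).neg), gy, arr_x, arr_y,
      mul_add (extend _), mul_one (extend _), ← extend_mul, ← extend_mul, ← extend_add, ← extend_neg]
    congr 1
    calc proj α i * -(A * (1 + matY p * matX p))
        = -(proj α i * A + proj α i * A * matY p * matX p) := by noncomm_ring
      _ = -(proj α i * A + proj α i * (proj α i * A) * matY p * matX p) := by
        rw [← mul_assoc (proj α i), hpp]
      _ = -(proj α i * A + proj α i * A * (proj α (i + 1) * matY p) * matX p) := by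
        rw [show proj α i * (proj α i * A) = proj α i * A * proj α (i + 1) by rw [mul_assoc, ← pA]]
        noncomm_ring
      _ = -(proj α i * A + proj α i * A * (matY p * (proj α i * proj α i)) * matX p) := by
        rw [pY, hpp]
      _ = _ := by noncomm_ring
  · rw [arr_y, matY_setXY _ (by simpa using (hB.mul hXY)), gx, arr_x, arr_y,
      mul_add (extend _), mul_one (extend _), ← extend_mul, ← extend_mul, ← extend_add]
    congr 1
    calc B * (1 + matX p * matY p) * proj α i
        = B * proj α i + B * matX p * (matY p * proj α i) := by noncomm_ring
      _ = B * proj α i + B * matX p * (matY p * (proj α i * proj α i)) := by rw [hpp]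
      _ = B * proj α i + B * matX p * (proj α (i + 1) * matY p * proj α i) := by
        rw [pY]; noncomm_ring
      _ = B * proj α i + B * (proj α i * matX p) * (matY p * proj α i) := by
        rw [pX]; noncomm_ring
      _ = B * proj α i + B * ((proj α i * proj α i) * matX p) * (matY p * proj α i) := by rw [hpp]
      _ = _ := by noncomm_ring

end GradXY

/-! ### Regular functions and their derivatives. -/

section Regular

variable {m : ℕ} {α : ZMod m → ℕ} {D f g : Rep α → ℂ}

namespace IsRegular

theorem congr (hf : IsRegular D f) (h : ∀ p, D p ≠ 0 → g p = f p) : IsRegular D g := by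
  obtain ⟨P, n, hP⟩ := hf
  exact ⟨P, n, fun p hp => (h p hp).trans (hP p hp)⟩

theorem of_eval {P : MvPolynomial (Coord α) ℂ} (h : ∀ p, f p = MvPolynomial.eval p P) :
    IsRegular D f := ⟨P, 0, fun p _ => by simp [h]⟩

theorem of_one (h : IsRegular (fun _ => 1) f) : IsRegular D f := by
  obtain ⟨P, n, hP⟩ := h
  exact of_eval (P := P) fun p => by simpa using hP p one_ne_zero

/-- With denominator `1`, regular means polynomial; `IsRegular (fun _ => 1) D` is used in this sense
throughout. -/
theorem exists_eval (h : IsRegular (fun _ => 1) f) :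
    ∃ P : MvPolynomial (Coord α) ℂ, ∀ p, f p = MvPolynomial.eval p P := by
  obtain ⟨P, n, hP⟩ := h
  exact ⟨P, fun p => by simpa using hP p one_ne_zero⟩

theorem const (c : ℂ) : IsRegular D fun _ => c := of_eval (P := MvPolynomial.C c) (by simp)

theorem coord (c : Coord α) : IsRegular D fun p => p c := of_eval (P := MvPolynomial.X c) (by simp)

theorem one_div : IsRegular D fun p => 1 / D p := ⟨1, 1, fun p _ => by simp⟩

theorem add (hD : IsRegular (fun _ => 1) D) (hf : IsRegular D f) (hg : IsRegular D g) :
    IsRegular D fun p => f p + g p := by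
  obtain ⟨Q, hQ⟩ := hD.exists_eval
  obtain ⟨P, n, hP⟩ := hf
  obtain ⟨P', n', hP'⟩ := hg
  refine ⟨P * Q ^ n' + P' * Q ^ n, n + n', fun p hp => ?_⟩
  beta_reduce
  rw [hP p hp, hP' p hp, map_add, map_mul, map_mul, map_pow, map_pow, ← hQ]
  field_simp
  ring

theorem mul (hf : IsRegular D f) (hg : IsRegular D g) : IsRegular D fun p => f p * g p := by
  obtain ⟨P, n, hP⟩ := hf
  obtain ⟨P', n', hP'⟩ := hg
  refine ⟨P * P', n + n', fun p hp => ?_⟩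
  beta_reduce
  rw [hP p hp, hP' p hp, map_mul, pow_add]
  field_simp

theorem neg (hf : IsRegular D f) : IsRegular D fun p => -f p := by
  simpa using (const (-1)).mul hf

theorem sum (hD : IsRegular (fun _ => 1) D) {ι : Type*} (s : Finset ι) {F : ι → Rep α → ℂ}
    (h : ∀ i ∈ s, IsRegular D (F i)) : IsRegular D fun p => ∑ i ∈ s, F i p := by
  classical
  induction s using Finset.induction_on with
  | empty => simpa using const 0
  | insert i s hi ih =>
    simp only [Finset.sum_insert hi]
    exact add hD (h i (by simp)) (ih fun j hj => h j (by simp [hj]))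

theorem prod {ι : Type*} (s : Finset ι) {F : ι → Rep α → ℂ}
    (h : ∀ i ∈ s, IsRegular D (F i)) : IsRegular D fun p => ∏ i ∈ s, F i p := by
  classical
  induction s using Finset.induction_on with
  | empty => simpa using const 1
  | insert i s hi ih =>
    simp only [Finset.prod_insert hi]
    exact mul (h i (by simp)) (ih fun j hj => h j (by simp [hj]))

theorem pow (hf : IsRegular D f) (n : ℕ) : IsRegular D fun p => f p ^ n := by
  simpa using prod (Finset.range n) (F := fun _ => f) fun _ _ => hf

end IsRegular

variable [NeZero m]

theorem hasFDerivAt_eval (P : MvPolynomial (Coord α) ℂ) (p : Rep α) :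
    HasFDerivAt (fun q : Rep α => MvPolynomial.eval q P)
      (∑ c, MvPolynomial.eval p (MvPolynomial.pderiv c P) •
        (ContinuousLinearMap.proj c : Rep α →L[ℂ] ℂ)) p := by
  induction P using MvPolynomial.induction_on with
  | C a =>
    simp only [MvPolynomial.eval_C]
    exact (hasFDerivAt_const (𝕜 := ℂ) a p).congr_fderiv (by ext v; simp)
  | add P Q hP hQ =>
    simp only [map_add]
    refine (hP.fun_add hQ).congr_fderiv ?_
    ext v
    simp [add_mul, Finset.sum_add_distrib]
  | mul_X P c hP =>
    have h := hP.mul ((ContinuousLinearMap.proj c : Rep α →L[ℂ] ℂ).hasFDerivAt (x := p))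
    simp only [map_mul, MvPolynomial.eval_X]
    refine h.congr_fderiv ?_
    ext v
    simp [MvPolynomial.pderiv_X, Pi.single_apply, Finset.sum_add_distrib, Finset.mul_sum,
      add_mul, apply_ite, mul_assoc]

namespace IsRegular

theorem eventually_ne (hD : IsRegular (fun _ => 1) D) {p : Rep α} (hp : D p ≠ 0) :
    ∀ᶠ q in nhds p, D q ≠ 0 := by
  obtain ⟨Q, hQ⟩ := hD.exists_eval
  have : ContinuousAt D p := by
    rw [funext hQ]
    exact (hasFDerivAt_eval Q p).continuousAt
  exact this.eventually_ne hp

theorem differentiableAt (hD : IsRegular (fun _ => 1) D) (hf : IsRegular D f) {p : Rep α}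
    (hp : D p ≠ 0) : DifferentiableAt ℂ f p := by
  obtain ⟨P, n, hP⟩ := hf
  obtain ⟨Q, hQ⟩ := hD.exists_eval
  have hD' : DifferentiableAt ℂ D p := by
    rw [funext hQ]
    exact (hasFDerivAt_eval Q p).differentiableAt
  refine DifferentiableAt.congr_of_eventuallyEq (f := fun p => MvPolynomial.eval p P / D p ^ n) ?_
    ((eventually_ne hD hp).mono hP)
  have hP' := (hasFDerivAt_eval P p).differentiableAt
  have hDn := pow_ne_zero n hp
  fun_prop (disch := assumption)

/-- With `Q` the polynomial `D`, differentiate `f * Q ^ n = P`, valid near any point with `D ≠ 0`,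
and solve for the derivative of `f`. It is a polynomial expression in regular functions and `1 / D`.
-/
theorem fderiv_single (hD : IsRegular (fun _ => 1) D) (hf : IsRegular D f) (c : Coord α) :
    IsRegular D fun p => fderiv ℂ f p (Pi.single c 1) := by
  have hf' := hf
  obtain ⟨P, n, hP⟩ := hf
  obtain ⟨Q, hQ⟩ := hD.exists_eval
  have key : ∀ p, D p ≠ 0 → fderiv ℂ f p (Pi.single c 1)
      = (MvPolynomial.eval p (MvPolynomial.pderiv c P)
        + -(f p * MvPolynomial.eval p (MvPolynomial.pderiv c (Q ^ n)))) * (1 / D p) ^ n := by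
    intro p hp
    have h1 := (differentiableAt hD hf' hp).hasFDerivAt.mul (hasFDerivAt_eval (Q ^ n) p)
    have h2 := (hasFDerivAt_eval P p).congr_of_eventuallyEq
      (f₁ := fun q => f q * MvPolynomial.eval q (Q ^ n)) (by
        filter_upwards [eventually_ne hD hp] with q hq
        rw [hP q hq, map_pow, ← hQ]
        have := pow_ne_zero n hq
        field_simp)
    have h3 := congrArg (fun l : Rep α →L[ℂ] ℂ => l (Pi.single c 1)) (h1.unique h2)
    simp [Pi.single_apply, -Derivation.leibniz_pow, -map_pow] at h3
    rw [show MvPolynomial.eval p (Q ^ n) = D p ^ n by rw [map_pow, ← hQ]] at h3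
    rw [_root_.one_div, inv_pow, eq_mul_inv_iff_mul_eq₀ (pow_ne_zero n hp), ← h3]
    ring
  refine congr ?_ key
  exact mul (add hD (of_eval fun _ => rfl) (neg (mul hf' (of_eval fun _ => rfl)))) (one_div.pow n)

theorem fderiv_apply (hD : IsRegular (fun _ => 1) D) (hf : IsRegular D f) {v : Rep α → Rep α}
    (hv : ∀ c, IsRegular D fun p => v p c) : IsRegular D fun p => fderiv ℂ f p (v p) := by
  have : (fun p => fderiv ℂ f p (v p)) = fun p => ∑ c, v p c * fderiv ℂ f p (Pi.single c 1) := by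
    funext p
    conv_lhs => rw [pi_eq_sum_univ' (v p)]
    simp [map_sum]
  rw [this]
  exact sum hD _ fun c _ => (hv c).mul (fderiv_single hD hf c)

end IsRegular

/-- A matrix of regular functions. -/
def IsRegularMatrix {ι κ : Type*} (D : Rep α → ℂ) (M : Rep α → Matrix ι κ ℂ) : Prop :=
  ∀ r s, IsRegular D fun p => M p r s

namespace IsRegularMatrix

variable {ι : Type*} [Fintype ι] [DecidableEq ι] {M N : Rep α → Matrix ι ι ℂ}

theorem one : IsRegularMatrix D fun _ => (1 : Matrix ι ι ℂ) := fun _ _ => .const _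

theorem add (hD : IsRegular (fun _ => 1) D) (hM : IsRegularMatrix D M) (hN : IsRegularMatrix D N) :
    IsRegularMatrix D fun p => M p + N p := fun r s => .add hD (hM r s) (hN r s)

theorem neg (hM : IsRegularMatrix D M) : IsRegularMatrix D fun p => -M p :=
  fun r s => (hM r s).neg

theorem mul (hD : IsRegular (fun _ => 1) D) (hM : IsRegularMatrix D M) (hN : IsRegularMatrix D N) :
    IsRegularMatrix D fun p => M p * N p := fun r s => by
  simp only [Matrix.mul_apply]
  exact .sum hD _ fun u _ => (hM r u).mul (hN u s)

theorem pow (hD : IsRegular (fun _ => 1) D) (hM : IsRegularMatrix D M) (n : ℕ) :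
    IsRegularMatrix D fun p => M p ^ n := by
  induction n with
  | zero => simpa using one
  | succ n ih => simpa only [pow_succ] using ih.mul hD hM

theorem det (hD : IsRegular (fun _ => 1) D) (hM : IsRegularMatrix D M) :
    IsRegular D fun p => (M p).det := by
  simp only [Matrix.det_apply']
  exact .sum hD _ fun σ _ => (IsRegular.const _).mul (.prod _ fun i _ => hM _ _)

theorem trace (hD : IsRegular (fun _ => 1) D) (hM : IsRegularMatrix D M) :
    IsRegular D fun p => (M p).trace := .sum hD _ fun i _ => hM i i

theorem inv (hD : IsRegular (fun _ => 1) D) (hM : IsRegularMatrix D M)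
    (hdet : IsRegular D fun p => (M p).det⁻¹) : IsRegularMatrix D fun p => (M p)⁻¹ := by
  intro r s
  simp only [Matrix.inv_def, Matrix.smul_apply, Ring.inverse_eq_inv', Matrix.adjugate_apply,
    smul_eq_mul]
  refine hdet.mul (det hD fun i j => ?_)
  by_cases h : i = s
  · subst h
    simpa using .const _
  · simpa [Matrix.updateRow_ne h] using hM i j

end IsRegularMatrix

theorem isRegularMatrix_arr (a : Arrow m) : IsRegularMatrix D fun p : Rep α => arr p a := by
  intro r s
  by_cases h : r.1 = a.tail ∧ s.1 = a.head
  · simpa only [arr, dif_pos h] using .coord _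
  · simpa only [arr, dif_neg h] using .const 0

theorem isRegularMatrix_matX : IsRegularMatrix D fun p : Rep α => matX p :=
  fun _ _ => isRegularMatrix_arr _ _ _

theorem isRegularMatrix_matY : IsRegularMatrix D fun p : Rep α => matY p :=
  fun _ _ => isRegularMatrix_arr _ _ _

theorem isRegular_one_one : IsRegular (fun _ => 1) fun _ : Rep α => (1 : ℂ) := .const 1

theorem isRegular_detA : IsRegular (fun _ => 1) (detA α) :=
  .prod _ fun a _ => (IsRegularMatrix.one.add isRegular_one_one
    ((isRegularMatrix_arr a).mul isRegular_one_one (isRegularMatrix_arr a.star))).det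
      isRegular_one_one

theorem isRegular_detAX : IsRegular (fun _ => 1) (detAX α) :=
  isRegular_detA.mul (isRegularMatrix_matX.det isRegular_one_one)

theorem isRegular_setXY {U W : Rep α → Matrix (IdxI α) (IdxI α) ℂ} (hU : IsRegularMatrix D U)
    (hW : IsRegularMatrix D W) (c : Coord α) : IsRegular D fun p => setXY 0 (U p) (W p) c := by
  have he : ∀ {M : Rep α → Matrix (IdxI α) (IdxI α) ℂ}, IsRegularMatrix D M →
      IsRegularMatrix D fun p => extend (M p) := by
    rintro M hM ⟨_ | i, a⟩ ⟨_ | j, b⟩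
    · exact .const 0
    · exact .const 0
    · exact .const 0
    · exact hM _ _
  obtain ⟨⟨_ | _ | _ | _, r, s⟩, hc⟩ := c
  · exact he hU r s
  · exact he hW r s
  · exact .const 0
  · exact .const 0

end Regular

/-! ### Change of bases. -/

section Action

variable {m : ℕ} [NeZero m] {α : ZMod m → ℕ}

/-- The change of bases on `⨁ i, ℂ ^ (α i)`. -/
def baseChange (g : ∀ v : Option (ZMod m), GL (Fin (dim α v)) ℂ) :
    (Matrix (IdxI α) (IdxI α) ℂ)ˣ where
  val := Matrix.blockDiagonal' fun i => (g (some i) : Matrix (Fin (α i)) (Fin (α i)) ℂ)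
  inv := Matrix.blockDiagonal' fun i =>
    (((g (some i))⁻¹ : GL (Fin (α i)) ℂ) : Matrix (Fin (α i)) (Fin (α i)) ℂ)
  val_inv := by
    rw [← Matrix.blockDiagonal'_mul, ← Matrix.blockDiagonal'_one]
    congr 1
    funext i
    exact Units.mul_inv _
  inv_val := by
    rw [← Matrix.blockDiagonal'_mul, ← Matrix.blockDiagonal'_one]
    congr 1
    funext i
    exact Units.inv_mul _

/-- The change of bases on the total space, framing vertex included. -/
def totalChange (g : ∀ v : Option (ZMod m), GL (Fin (dim α v)) ℂ) :
    (Matrix (Idx α) (Idx α) ℂ)ˣ where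
  val := Matrix.blockDiagonal' fun v => (g v : Matrix (Fin (dim α v)) (Fin (dim α v)) ℂ)
  inv := Matrix.blockDiagonal' fun v =>
    (((g v)⁻¹ : GL (Fin (dim α v)) ℂ) : Matrix (Fin (dim α v)) (Fin (dim α v)) ℂ)
  val_inv := by
    rw [← Matrix.blockDiagonal'_mul, ← Matrix.blockDiagonal'_one]
    congr 1
    funext i
    exact Units.mul_inv _
  inv_val := by
    rw [← Matrix.blockDiagonal'_mul, ← Matrix.blockDiagonal'_one]
    congr 1
    funext i
    exact Units.inv_mul _

theorem blockDiagonal'_some (G : ∀ v : Option (ZMod m), Matrix (Fin (dim α v)) (Fin (dim α v)) ℂ)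
    (i j : ZMod m) (a : Fin (α i)) (b : Fin (α j)) :
    Matrix.blockDiagonal' G ⟨some i, a⟩ ⟨some j, b⟩
      = Matrix.blockDiagonal' (fun i => G (some i)) (⟨i, a⟩ : IdxI α) ⟨j, b⟩ := by
  by_cases h : i = j
  · subst h
    rw [Matrix.blockDiagonal'_apply_eq, Matrix.blockDiagonal'_apply_eq]
  · rw [Matrix.blockDiagonal'_apply_ne _ _ _ h,
      Matrix.blockDiagonal'_apply_ne _ _ _ fun h' => h (Option.some_injective _ h')]

theorem blockDiagonal'_mul_extend
    (G : ∀ v : Option (ZMod m), Matrix (Fin (dim α v)) (Fin (dim α v)) ℂ)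
    (M : Matrix (IdxI α) (IdxI α) ℂ) :
    Matrix.blockDiagonal' G * extend M
      = extend (Matrix.blockDiagonal' (fun i => G (some i)) * M) := by
  have h0 : ∀ a j b, Matrix.blockDiagonal' G ⟨none, a⟩ ⟨some j, b⟩ = 0 := fun a j b =>
    Matrix.blockDiagonal'_apply_ne _ _ _ (by simp)
  ext ⟨_ | i, a⟩ ⟨_ | j, b⟩ <;>
    simp [extend, Matrix.mul_apply, Fintype.sum_sigma, Fintype.sum_option, h0, blockDiagonal'_some]

theorem extend_mul_blockDiagonal'
    (G : ∀ v : Option (ZMod m), Matrix (Fin (dim α v)) (Fin (dim α v)) ℂ)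
    (M : Matrix (IdxI α) (IdxI α) ℂ) :
    extend M * Matrix.blockDiagonal' G
      = extend (M * Matrix.blockDiagonal' (fun i => G (some i))) := by
  have h0 : ∀ a j b, Matrix.blockDiagonal' G ⟨some j, b⟩ ⟨none, a⟩ = 0 := fun a j b =>
    Matrix.blockDiagonal'_apply_ne _ _ _ (by simp)
  ext ⟨_ | i, a⟩ ⟨_ | j, b⟩ <;>
    simp [extend, Matrix.mul_apply, Fintype.sum_sigma, Fintype.sum_option, h0, blockDiagonal'_some]

section ConjBy

variable {ι : Type*} [Fintype ι] [DecidableEq ι] (u : (Matrix ι ι ℂ)ˣ) (M N : Matrix ι ι ℂ)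

/-- Conjugation by an invertible matrix. -/
def conjBy : Matrix ι ι ℂ := u.val * M * u.inv

theorem conjBy_mul : conjBy u (M * N) = conjBy u M * conjBy u N := by
  have : u.val * M * u.inv * (u.val * N * u.inv) = u.val * M * (u.inv * u.val) * N * u.inv := by
    noncomm_ring
  rw [conjBy, conjBy, conjBy, this, u.inv_val]
  noncomm_ring

theorem conjBy_one : conjBy u 1 = 1 := by rw [conjBy, mul_one, u.val_inv]

theorem conjBy_add : conjBy u (M + N) = conjBy u M + conjBy u N := by
  rw [conjBy, mul_add, add_mul]; rfl

theorem conjBy_neg : conjBy u (-M) = -conjBy u M := by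
  rw [conjBy, mul_neg, neg_mul]; rfl

theorem conjBy_zero : conjBy u 0 = 0 := by rw [conjBy, mul_zero, zero_mul]

theorem conjBy_pow (n : ℕ) : conjBy u (M ^ n) = conjBy u M ^ n := by
  induction n with
  | zero => simp [conjBy_one]
  | succ n ih => rw [pow_succ, pow_succ, conjBy_mul, ih]

theorem det_conjBy : (conjBy u M).det = M.det := Matrix.det_units_conj u M

theorem conjBy_inv (h : IsUnit M.det) : conjBy u M⁻¹ = (conjBy u M)⁻¹ := by
  refine (Matrix.inv_eq_left_inv ?_).symm
  rw [← conjBy_mul, Matrix.nonsing_inv_mul M h, conjBy_one]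

end ConjBy

variable (g : ∀ v : Option (ZMod m), GL (Fin (dim α v)) ℂ) (p : Rep α)

/-- `act` retains only the entries that fit the arrow. The conjugate has no others, since the
conjugating matrix is block-diagonal. -/
theorem arr_act (a : Arrow m) : arr (act g p) a = conjBy (totalChange g) (arr p a) := by
  ext r s
  by_cases h : r.1 = a.tail ∧ s.1 = a.head
  · rw [arr, dif_pos h]
    rfl
  · rw [arr_eq_zero _ h, conjBy, Matrix.mul_apply]
    refine (Finset.sum_eq_zero fun u _ => ?_).symm
    by_cases hs : u.1 = s.1
    · rw [Matrix.mul_apply, Finset.sum_eq_zero fun v _ => ?_, zero_mul]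
      by_cases hr : r.1 = v.1
      · rw [arr_eq_zero p (by rwa [← hr, hs]), mul_zero]
      · have : (totalChange g).val r v = 0 := by
          simp only [totalChange]
          exact dif_neg hr
        rw [this, zero_mul]
    · have : (totalChange g).inv u s = 0 := by
        simp only [totalChange]
        exact dif_neg hs
      rw [this, mul_zero]

theorem conjBy_totalChange_extend (M : Matrix (IdxI α) (IdxI α) ℂ) :
    conjBy (totalChange g) (extend M) = extend (conjBy (baseChange g) M) := by
  simp only [conjBy, totalChange, baseChange, blockDiagonal'_mul_extend, extend_mul_blockDiagonal']

theorem isHomogeneous_baseChange : IsHomogeneous 0 (baseChange g).val ∧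
    IsHomogeneous 0 (baseChange g).inv := by
  constructor <;>
  · rintro ⟨i, a⟩ ⟨j, b⟩ h
    simp only [baseChange]
    exact Matrix.blockDiagonal'_apply_ne _ _ _ fun h' => h (by simpa using h'.symm)

theorem IsHomogeneous.conjBy {d : ZMod m} {M : Matrix (IdxI α) (IdxI α) ℂ}
    (hM : IsHomogeneous d M) : IsHomogeneous d (conjBy (baseChange g) M) := by
  have := ((isHomogeneous_baseChange g).1.mul hM).mul (isHomogeneous_baseChange g).2
  rwa [zero_add, add_zero] at this

theorem matX_act : matX (act g p) = conjBy (baseChange g) (matX p) := by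
  ext ⟨i, a⟩ ⟨j, b⟩
  rw [matX_apply, arr_act, arr_x, conjBy_totalChange_extend]
  show conjBy _ _ (⟨i, a⟩ : IdxI α) ⟨j, b⟩ = _
  rw [conjBy, ← mul_assoc, ← (by simpa using (isHomogeneous_baseChange g).1.proj_mul i :
    proj α i * (baseChange g).val = (baseChange g).val * proj α i), mul_assoc, mul_assoc,
    proj_mul_apply, if_pos rfl, conjBy, mul_assoc]

theorem matY_act : matY (act g p) = conjBy (baseChange g) (matY p) := by
  ext ⟨i, a⟩ ⟨j, b⟩
  rw [matY_apply, arr_act, arr_y, conjBy_totalChange_extend]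
  show conjBy _ _ (⟨i, a⟩ : IdxI α) ⟨j, b⟩ = _
  rw [conjBy, mul_assoc, mul_assoc, (by simpa using (isHomogeneous_baseChange g).2.proj_mul j :
    proj α j * (baseChange g).inv = (baseChange g).inv * proj α j), ← mul_assoc, ← mul_assoc,
    mul_proj_apply, if_pos rfl, conjBy]

theorem act_setXY_zero {X Y : Matrix (IdxI α) (IdxI α) ℂ} (hX : IsHomogeneous 1 X)
    (hY : IsHomogeneous (-1) Y) :
    act g (setXY 0 X Y) = setXY 0 (conjBy (baseChange g) X) (conjBy (baseChange g) Y) := by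
  refine rep_ext fun a => ?_
  cases a with
  | x i => rw [arr_x, arr_x, matX_act, matX_setXY _ hX, matX_setXY _ (hX.conjBy g)]
  | y i => rw [arr_y, arr_y, matY_act, matY_setXY _ hY, matY_setXY _ (hY.conjBy g)]
  | v =>
    rw [arr_act, arr_setXY_v, arr_setXY_v, show arr (0 : Rep α) .v = 0 by ext; simp [arr],
      conjBy_zero]
  | w =>
    rw [arr_act, arr_setXY_w, arr_setXY_w, show arr (0 : Rep α) .w = 0 by ext; simp [arr],
      conjBy_zero]

theorem detA_act : detA α (act g p) = detA α p := by
  refine Finset.prod_congr rfl fun a _ => ?_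
  rw [arr_act, arr_act, ← conjBy_mul, ← det_conjBy (totalChange g) (1 + arr p a * arr p a.star), conjBy_add,
    conjBy_one]

theorem detAX_act : detAX α (act g p) = detAX α p := by
  rw [detAX, detAX, detA_act, matX_act, det_conjBy]

/-- The action of a change of bases as a linear map. -/
def actLinear : Rep α →ₗ[ℂ] Rep α where
  toFun := act g
  map_add' p q := by
    have : ∀ a, arr (p + q) a = arr p a + arr q a := fun a => by
      ext r s
      by_cases h : r.1 = a.tail ∧ s.1 = a.head <;> simp [arr, h]
    funext c
    simp [act, this, mul_add, add_mul]
  map_smul' t p := by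
    have : ∀ a, arr (t • p) a = t • arr p a := fun a => by
      ext r s
      by_cases h : r.1 = a.tail ∧ s.1 = a.head <;> simp [arr, h]
    funext c
    simp [act, this]

end Action

/-! ### Uniqueness of integral curves tested by functions. -/

section Uniqueness

/-- As `S` is stable under `δ`, every derivative of `f ∘ c₁ - f ∘ c₂` has the form `k ∘ c₁ - k ∘ c₂`
with `k ∈ S`, so it vanishes at `0`. A complex differentiable function is analytic, hence this
difference vanishes on the preconnected open set `U`. No structure on `E` is needed, so `c₁`, `c₂`
may be arbitrary lifts of curves in a quotient. -/
theorem eq_of_forall_hasDerivAt {E : Type*} {S : Set (E → ℂ)} {δ : (E → ℂ) → E → ℂ}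
    (hS : ∀ f ∈ S, δ f ∈ S) {c₁ c₂ : ℂ → E} {U : Set ℂ} (hU : IsOpen U) (hU' : IsPreconnected U)
    (h0 : (0 : ℂ) ∈ U)
    (h₁ : ∀ f ∈ S, ∀ t ∈ U, HasDerivAt (fun s => f (c₁ s)) (δ f (c₁ t)) t)
    (h₂ : ∀ f ∈ S, ∀ t ∈ U, HasDerivAt (fun s => f (c₂ s)) (δ f (c₂ t)) t)
    (hc : ∀ f ∈ S, f (c₁ 0) = f (c₂ 0)) {f : E → ℂ} (hf : f ∈ S) {t : ℂ} (ht : t ∈ U) :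
    f (c₁ t) = f (c₂ t) := by
  have hd : ∀ f ∈ S, ∀ t ∈ U,
      HasDerivAt (fun s => f (c₁ s) - f (c₂ s)) (δ f (c₁ t) - δ f (c₂ t)) t :=
    fun f hf t ht => (h₁ f hf t ht).fun_sub (h₂ f hf t ht)
  have hit : ∀ (n : ℕ), ∀ f ∈ S, ∃ k ∈ S, ∀ t ∈ U,
      iteratedDeriv n (fun s => f (c₁ s) - f (c₂ s)) t = k (c₁ t) - k (c₂ t) := by
    intro n f hf
    induction n with
    | zero => exact ⟨f, hf, fun t _ => by simp⟩
    | succ n ih =>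
      obtain ⟨k, hk, hkt⟩ := ih
      refine ⟨δ k, hS k hk, fun t ht => ?_⟩
      rw [iteratedDeriv_succ, ← (hd k hk t ht).deriv]
      exact Filter.EventuallyEq.deriv_eq (Filter.eventually_of_mem (hU.mem_nhds ht) hkt)
  have han : AnalyticOnNhd ℂ (fun s => f (c₁ s) - f (c₂ s)) U :=
    DifferentiableOn.analyticOnNhd
      (fun t ht => (hd f hf t ht).differentiableAt.differentiableWithinAt) hU
  have htop : analyticOrderAt (fun s => f (c₁ s) - f (c₂ s)) 0 = ⊤ := by
    rw [ENat.eq_top_iff_forall_ge]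
    intro n
    rw [natCast_le_analyticOrderAt_iff_iteratedDeriv_eq_zero (han 0 h0)]
    intro i _
    obtain ⟨k, hk, hkt⟩ := hit i f hf
    rw [hkt 0 h0, hc k hk, sub_self]
  rw [analyticOrderAt_eq_top] at htop
  exact sub_eq_zero.1
    (han.eqOn_zero_of_preconnected_of_eventuallyEq_zero hU' h0 htop ht)

end Uniqueness

/-! ### From an equivariant Hamiltonian field to complete solutions. -/

section CompleteSolution

variable {m : ℕ} [NeZero m] {α : ZMod m → ℕ} {q : ZMod m → ℂˣ} {D H : Rep α → ℂ}

/-- The vector field `v` is regular and equivariant on the invariant principal open subset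
`{D ≠ 0}` of `{detA ≠ 0}`, and it is the Hamiltonian vector field of `H` there. -/
structure IsHamiltonianField (D H : Rep α → ℂ) (v : Rep α → Rep α) : Prop where
  regular_D : IsRegular (fun _ => 1) D
  factor : ∃ D', IsRegular (fun _ => 1) D' ∧ ∀ p, D p = detA α p * D' p
  inv_D : ∀ g p, D (act g p) = D p
  regular : ∀ c, IsRegular D fun p => v p c
  equivariant : ∀ g p, D p ≠ 0 → v (act g p) = act g (v p)
  bracket_eq : ∀ f p, D p ≠ 0 → bracket H f p = fderiv ℂ f p (v p)

namespace IsHamiltonianField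

variable {v : Rep α → Rep α}

theorem isRegular_bracket (h : IsHamiltonianField D H v) {f : Rep α → ℂ} (hf : IsRegular D f) :
    IsRegular D (bracket H f) :=
  (IsRegular.fderiv_apply h.regular_D hf h.regular).congr fun p hp => h.bracket_eq f p hp

/-- Differentiating `f ∘ act g = f` at `p` gives `df_{g p} (g v) = df_p (v)`; equivariance of `v`
turns this into invariance of the bracket. -/
theorem isInvRegular_bracket (h : IsHamiltonianField D H v) {f : Rep α → ℂ}
    (hf : IsInvRegular D f) : IsInvRegular D (bracket H f) := by
  refine ⟨h.isRegular_bracket hf.1, fun g p hp => ?_⟩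
  have hgp : D (act g p) ≠ 0 := by rwa [h.inv_D]
  rw [h.bracket_eq _ _ hp, h.bracket_eq _ _ hgp, h.equivariant g p hp]
  have h1 : HasFDerivAt (act g) (LinearMap.toContinuousLinearMap (actLinear g)) p :=
    (LinearMap.toContinuousLinearMap (actLinear g)).hasFDerivAt
  have h2 := (IsRegular.differentiableAt h.regular_D hf.1 hgp).hasFDerivAt.comp p h1
  have h3 : HasFDerivAt (f ∘ act g) (fderiv ℂ f p) p :=
    (IsRegular.differentiableAt h.regular_D hf.1 hp).hasFDerivAt.congr_of_eventuallyEq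
      ((IsRegular.eventually_ne h.regular_D hp).mono fun q hq => hf.2 g q hq)
  exact congrArg (fun l : Rep α →L[ℂ] ℂ => l (v p)) (h2.unique h3)

theorem isRegular_of_detA (h : IsHamiltonianField D H v) {f : Rep α → ℂ}
    (hf : IsInvRegular (detA α) f) : IsInvRegular D f := by
  obtain ⟨D', hD', hDD'⟩ := h.factor
  obtain ⟨Q, hQ⟩ := hD'.exists_eval
  have hA : ∀ p, D p ≠ 0 → detA α p ≠ 0 ∧ D' p ≠ 0 := fun p hp => by
    rw [hDD'] at hp
    exact ⟨left_ne_zero_of_mul hp, right_ne_zero_of_mul hp⟩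
  refine ⟨?_, fun g p hp => hf.2 g p (hA p hp).1⟩
  obtain ⟨P, n, hP⟩ := hf.1
  refine ⟨P * Q ^ n, n, fun p hp => ?_⟩
  rw [hP p (hA p hp).1, hDD', map_mul, map_pow, ← hQ]
  have := (hA p hp).2
  have := (hA p hp).1
  rw [mul_pow]
  field_simp

/-- Points of the quotient are separated by functions regular on `{detA ≠ 0}`; denominators in `D`
are cleared to reach functions regular only on `{D ≠ 0}`. -/
theorem eq_of_rel (h : IsHamiltonianField D H v) {p p' : repLambda α q}
    (hpp : toVariety p = toVariety p') (hp : D p ≠ 0) :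
    D p' ≠ 0 ∧ ∀ f, IsInvRegular D f → f p = f p' := by
  have hrel : ∀ f, IsInvRegular (detA α) f → f p = f p' := Quotient.exact hpp
  have hDD : D p = D p' := hrel D ⟨h.regular_D.of_one, fun g p _ => h.inv_D g p⟩
  refine ⟨hDD ▸ hp, fun f hf => ?_⟩
  obtain ⟨⟨P, n, hP⟩, hinv⟩ := hf
  have key : ∀ q, D q ≠ 0 → MvPolynomial.eval q P = f q * D q ^ n := fun q hq => by
    rw [hP q hq, div_mul_cancel₀ _ (pow_ne_zero n hq)]
  -- The numerator `P` is known to be invariant only where `D ≠ 0`. The extra factor `D` makes the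
  -- product vanish elsewhere, hence invariant everywhere.
  have := hrel (fun q => MvPolynomial.eval q P * D q)
    ⟨(IsRegular.of_eval fun _ => rfl).mul h.regular_D.of_one, fun g q _ => by
      by_cases hq : D q = 0
      · simp [h.inv_D, hq]
      · simp only
        rw [key _ (by rwa [h.inv_D]), h.inv_D, hinv g q hq, key q hq]⟩
  rw [key _ hp, key _ (hDD ▸ hp), ← hDD] at this
  exact mul_right_cancel₀ (pow_ne_zero n hp) (mul_right_cancel₀ hp this)

theorem isCompleteSolution (h : IsHamiltonianField D H v) {p : repLambda α q}
    {γ : ℂ → repLambda α q} (h0 : γ 0 = p) (hD : ∀ t, D (γ t) ≠ 0)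
    (hγ : ∀ t, HasDerivAt (fun s => (γ s : Rep α)) (v (γ t)) t) : IsCompleteSolution D H p γ := by
  have hrep : ∀ f, IsRegular D f → ∀ t, HasDerivAt (fun s => f (γ s)) (bracket H f (γ t)) t := by
    intro f hf t
    rw [h.bracket_eq f _ (hD t)]
    exact (IsRegular.differentiableAt h.regular_D hf (hD t)).hasFDerivAt.comp_hasDerivAt t (hγ t)
  refine ⟨h0, hD, fun t _ => ⟨hD t, fun f hf => hrep f hf t⟩, ?_, ?_, ?_⟩
  · intro U c hU hU' hU0 hc0 hc t ht
    funext i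
    exact eq_of_forall_hasDerivAt (S := {f | IsRegular D f}) (δ := bracket H)
      (c₁ := c) (c₂ := fun s => (γ s : Rep α)) (fun f hf => h.isRegular_bracket hf) hU hU' hU0
      (fun f hf s hs => (hc s hs).2 f hf) (fun f hf s _ => hrep f hf s)
      (fun f _ => by rw [hc0, h0]) (f := fun p => p i) (IsRegular.coord i) ht
  -- An arbitrary lift `p'` need not be continuous, but invariant functions take the same values on
  -- it as on `γ`.
  · intro p' hp' t _
    have hr := fun s => h.eq_of_rel (hp' s).symm (hD s)
    refine ⟨(hr t).1, fun f hf => ?_⟩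
    rw [← (hr t).2 _ (h.isInvRegular_bracket hf), ← funext fun s => (hr s).2 f hf]
    exact hrep f hf.1 t
  · intro U c hU hU' hU0 hc0 hc t ht
    obtain ⟨p', hp'⟩ : ∃ p' : ℂ → repLambda α q, ∀ s, toVariety (p' s) = c s :=
      ⟨fun s => (c s).out, fun s => Quotient.out_eq (c s)⟩
    have hc' := hc p' hp'
    rw [← hp' t]
    refine Quotient.sound fun f hf => ?_
    exact eq_of_forall_hasDerivAt (S := {f | IsInvRegular D f}) (δ := bracket H)
      (c₁ := fun s => (p' s : Rep α)) (c₂ := fun s => (γ s : Rep α))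
      (fun f hf => h.isInvRegular_bracket hf) hU hU' hU0
      (fun f hf s hs => (hc' s hs).2 f hf) (fun f hf s _ => hrep f hf.1 s)
      (fun f hf => (h.eq_of_rel ((hp' 0).trans (hc0.trans (congrArg toVariety h0.symm)))
        (hc' 0 hU0).1).2 f hf) (h.isRegular_of_detA hf) ht

end IsHamiltonianField

end CompleteSolution

/-! ### Preservation of the multiplicative preprojective relations. -/

section Membership

variable {m : ℕ} [NeZero m] {α : ZMod m → ℕ} {q : ZMod m → ℂˣ}

/-- The endomorphism of the total space which is `M` on the vertex `i` and the identity
elsewhere. -/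
def blockAt (i : ZMod m) (M : Matrix (IdxI α) (IdxI α) ℂ) : Matrix (Idx α) (Idx α) ℂ :=
  1 - idem α (some i) + extend (proj α i * M)

theorem blockAt_one (i : ZMod m) : blockAt i (1 : Matrix (IdxI α) (IdxI α) ℂ) = 1 := by
  rw [blockAt, mul_one, extend_proj, sub_add_cancel]

theorem blockAt_mul (i : ZMod m) {M : Matrix (IdxI α) (IdxI α) ℂ} (hM : IsHomogeneous 0 M)
    (N : Matrix (IdxI α) (IdxI α) ℂ) : blockAt i (M * N) = blockAt i M * blockAt i N := by
  have h0 : idem α (some i) * idem α (some i) = idem α (some i) := by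
    rw [← extend_proj, ← extend_mul, proj_mul_proj]
  have h1 : idem α (some i) * extend (proj α i * N) = extend (proj α i * N) := by
    rw [idem_mul_extend, ← mul_assoc, proj_mul_proj]
  have hc : proj α i * M = M * proj α i := by simpa using hM.proj_mul i
  have h2 : extend (proj α i * M) * idem α (some i) = extend (proj α i * M) := by
    rw [extend_mul_idem, mul_assoc, ← hc, ← mul_assoc, proj_mul_proj]
  have h3 : extend (proj α i * M) * extend (proj α i * N) = extend (proj α i * (M * N)) := by
    rw [← extend_mul]
    congr 1
    rw [hc, mul_assoc, ← mul_assoc (proj α i), proj_mul_proj, ← mul_assoc, ← hc, mul_assoc]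
  simp only [blockAt, mul_add, add_mul, sub_mul, mul_sub, one_mul, mul_one, h0, h1, h2, h3]
  abel

theorem isUnit_blockAt (i : ZMod m) {M : Matrix (IdxI α) (IdxI α) ℂ} (hM : IsHomogeneous 0 M)
    (hu : IsUnit M) : IsUnit (blockAt i M) := by
  have h := (Matrix.isUnit_iff_isUnit_det M).1 hu
  refine IsUnit.of_mul_eq_one (blockAt i M⁻¹) ?_
  rw [← blockAt_mul i hM, Matrix.mul_nonsing_inv M h, blockAt_one]

theorem one_add_arr_x_mul_arr_y (p : Rep α) (i : ZMod m) :
    1 + arr p (.x i) * arr p (.y i) = blockAt i (1 + matX p * matY p) := by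
  have hXY : IsHomogeneous 0 (matX p * matY p) := by
    simpa using (isHomogeneous_matX p).mul (isHomogeneous_matY p)
  have hc : proj α i * (matX p * matY p) = matX p * matY p * proj α i := by
    simpa using hXY.proj_mul i
  rw [arr_x, arr_y, blockAt, ← extend_mul, mul_add, extend_add, mul_one, extend_proj,
    ← add_assoc, sub_add_cancel]
  congr 2
  rw [← mul_assoc, mul_assoc (proj α i), hc, mul_assoc, proj_mul_proj]

theorem one_add_arr_y_mul_arr_x (p : Rep α) (i : ZMod m) :
    1 + arr p (.y i) * arr p (.x i) = blockAt (i + 1) (1 + matY p * matX p) := by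
  have hc : proj α (i + 1) * matY p = matY p * proj α i := by
    rw [(isHomogeneous_matY p).proj_mul, add_neg_cancel_right]
  rw [arr_x, arr_y, blockAt, ← extend_mul, mul_add, extend_add, mul_one, extend_proj,
    ← add_assoc, sub_add_cancel]
  congr 2
  rw [← mul_assoc, mul_assoc (matY p), proj_mul_proj, ← hc, mul_assoc]

/-- Both factors of the cyclic part of the moment map at a vertex acquire the same block of `E` on
the left, and it cancels in `(E a)⁻¹ * (E b) = a⁻¹ * b`. The factors with `V` and `W` do not change,
so the relation at `∞` is inherited. -/
theorem setXY_mem_repLambda {p : Rep α} (hp : p ∈ repLambda α q)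
    {X Y E : Matrix (IdxI α) (IdxI α) ℂ} (hX : IsHomogeneous 1 X) (hY : IsHomogeneous (-1) Y)
    (hE : IsHomogeneous 0 E) (hu : IsUnit E) (hXY : 1 + X * Y = E * (1 + matX p * matY p))
    (hYX : 1 + Y * X = E * (1 + matY p * matX p)) : setXY p X Y ∈ repLambda α q := by
  have hx : ∀ i, 1 + arr (setXY p X Y) (.x i) * arr (setXY p X Y) (.y i)
      = blockAt i E * (1 + arr p (.x i) * arr p (.y i)) := fun i => by
    rw [one_add_arr_x_mul_arr_y, one_add_arr_x_mul_arr_y, matX_setXY p hX, matY_setXY p hY, hXY,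
      blockAt_mul i hE]
  have hy : ∀ i, 1 + arr (setXY p X Y) (.y i) * arr (setXY p X Y) (.x i)
      = blockAt (i + 1) E * (1 + arr p (.y i) * arr p (.x i)) := fun i => by
    rw [one_add_arr_y_mul_arr_x, one_add_arr_y_mul_arr_x, matX_setXY p hX, matY_setXY p hY, hYX,
      blockAt_mul (i + 1) hE]
  have hm : ∀ i : ZMod m,
      (1 + arr (setXY p X Y) (.y (i - 1)) * arr (setXY p X Y) (.x (i - 1)))⁻¹
        * (1 + arr (setXY p X Y) (.x i) * arr (setXY p X Y) (.y i))
      = (1 + arr p (.y (i - 1)) * arr p (.x (i - 1)))⁻¹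
        * (1 + arr p (.x i) * arr p (.y i)) := fun i => by
    have hd := (Matrix.isUnit_iff_isUnit_det _).1 (isUnit_blockAt i hE hu)
    rw [hx, hy, sub_add_cancel, Matrix.mul_inv_rev, mul_assoc, ← mul_assoc (blockAt i E)⁻¹,
      Matrix.nonsing_inv_mul _ hd, one_mul]
  obtain ⟨h1, h2, h3, h4⟩ := hp
  refine ⟨fun a => ?_, fun i hi => ?_, ?_, h4⟩
  · cases a with
    | x i =>
      rw [Arrow.star, hx]
      exact (isUnit_blockAt i hE hu).mul (h1 (.x i))
    | y i =>
      rw [Arrow.star, hy]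
      exact (isUnit_blockAt _ hE hu).mul (h1 (.y i))
    | v => exact h1 .v
    | w => exact h1 .w
  · rw [mul_assoc, hm, ← mul_assoc]
    exact h2 i hi
  · rw [mul_assoc (idem α (some 0)), hm, ← mul_assoc (idem α (some 0))]
    exact h3

theorem detA_ne_zero {p : Rep α} (hp : p ∈ repLambda α q) : detA α p ≠ 0 :=
  Finset.prod_ne_zero_iff.2 fun a _ => ((Matrix.isUnit_iff_isUnit_det _).1 (hp.1 a)).ne_zero

end Membership

/-! ### Derivatives of matrix-valued curves. -/

section MatrixCalculus

open scoped Matrix.Norms.Operator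

variable {ι : Type*} [Fintype ι] [DecidableEq ι]

theorem hasDerivAt_trace_pow {M : ℂ → Matrix ι ι ℂ} {M' : Matrix ι ι ℂ} {t : ℂ}
    (hM : HasDerivAt M M' t) {k : ℕ} (hk : 0 < k) :
    HasDerivAt (fun s => (1 / (k : ℂ)) * (M s ^ k).trace) (M t ^ (k - 1) * M').trace t := by
  have h1 : HasDerivAt (fun s => (1 / (k : ℂ)) * (M s ^ k).trace) ((1 / (k : ℂ)) *
      (∑ i ∈ Finset.range k, M t ^ (k.pred - i) * M' * M t ^ i).trace) t :=
    ((LinearMap.toContinuousLinearMap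
      (Matrix.traceLinearMap ι ℂ ℂ)).hasFDerivAt.comp_hasDerivAt t (hM.fun_pow' k)).const_mul
        (1 / (k : ℂ))
  refine h1.congr_deriv ?_
  have hk' : (k : ℂ) ≠ 0 := by exact_mod_cast hk.ne'
  have h2 : ∀ i ∈ Finset.range k,
      (M t ^ (k.pred - i) * M' * M t ^ i).trace = (M t ^ (k - 1) * M').trace := by
    intro i hi
    rw [Matrix.trace_mul_comm, ← mul_assoc, ← pow_add]
    congr 3
    have := Finset.mem_range.1 hi
    simp only [Nat.pred_eq_sub_one]
    omega
  rw [Matrix.trace_sum, Finset.sum_congr rfl h2]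
  simp
  field_simp

theorem hasDerivAt_nonsing_inv {M : ℂ → Matrix ι ι ℂ} {M' : Matrix ι ι ℂ} {t : ℂ}
    (hM : HasDerivAt M M' t) (hu : IsUnit (M t)) :
    HasDerivAt (fun s => (M s)⁻¹) (-((M t)⁻¹ * M' * (M t)⁻¹)) t := by
  obtain ⟨u, hu⟩ := hu
  have h := hasFDerivAt_ringInverse (𝕜 := ℂ) u
  rw [hu] at h
  have h2 := h.comp_hasDerivAt t hM
  simp only [Matrix.nonsing_inv_eq_ringInverse]
  refine h2.congr_deriv ?_
  rw [← hu]
  simp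

theorem hasDerivAt_exp_neg_smul (B : Matrix ι ι ℂ) (t : ℂ) :
    HasDerivAt (fun s : ℂ => NormedSpace.exp ((-s) • B))
      (-(B * NormedSpace.exp ((-t) • B))) t := by
  have he : (fun s : ℂ => NormedSpace.exp ((-s) • B)) = fun s => NormedSpace.exp (s • -B) := by
    simp
  rw [he]
  exact (hasDerivAt_exp_smul_const' (𝕂 := ℂ) (-B) t).congr_deriv (by simp; rfl)

theorem hasDerivAt_exp_smul (B : Matrix ι ι ℂ) (t : ℂ) :
    HasDerivAt (fun s : ℂ => NormedSpace.exp (s • B)) (NormedSpace.exp (t • B) * B) t :=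
  hasDerivAt_exp_smul_const (𝕂 := ℂ) B t

/-- This and the next three rules fix the operator norm, so that matrix curves can be differentiated
later without a norm in scope. -/
theorem hasDerivAt_matrix_const (C : Matrix ι ι ℂ) (t : ℂ) :
    HasDerivAt (fun _ : ℂ => C) 0 t := hasDerivAt_const t C

theorem hasDerivAt_matrix_add {M N : ℂ → Matrix ι ι ℂ} {M' N' : Matrix ι ι ℂ} {t : ℂ}
    (hM : HasDerivAt M M' t) (hN : HasDerivAt N N' t) :
    HasDerivAt (fun s => M s + N s) (M' + N') t := hM.fun_add hN

theorem hasDerivAt_matrix_mul_const {M : ℂ → Matrix ι ι ℂ} {M' : Matrix ι ι ℂ} {t : ℂ}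
    (hM : HasDerivAt M M' t) (C : Matrix ι ι ℂ) : HasDerivAt (fun s => M s * C) (M' * C) t :=
  hM.mul_const C

theorem hasDerivAt_matrix_const_sub_mul {M : ℂ → Matrix ι ι ℂ} {M' : Matrix ι ι ℂ} {t : ℂ}
    (hM : HasDerivAt M M' t) (B C : Matrix ι ι ℂ) :
    HasDerivAt (fun s => B - C * M s) (-(C * M')) t := (hM.const_mul C).const_sub B

theorem expQuot_mul_comm {k : ℕ} (hk : 0 < k) (t : ℂ) (B : Matrix ι ι ℂ) :
    expQuot k t B * B = B * expQuot k t B := by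
  have h := summable_expQuot_aux hk t B
  rw [expQuot, ← h.tsum_mul_left, ← h.tsum_mul_right]
  refine tsum_congr fun n => ?_
  rw [smul_mul_assoc, mul_smul_comm, pow_mul_comm']

/-- Termwise differentiation of the series: since `k * (n + 1) - 1 = (k - 1) + k * n`, the
derivatives form `-B ^ (k - 1)` times the exponential series. -/
theorem hasDerivAt_expQuot {k : ℕ} (hk : 0 < k) (t : ℂ) (B : Matrix ι ι ℂ) :
    HasDerivAt (fun s => expQuot k s B) (-(B ^ (k - 1) * NormedSpace.exp ((-t) • B ^ k))) t := by
  set F : ℕ → ℂ → Matrix ι ι ℂ := fun n s =>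
    ((-s) ^ (n + 1) / ((n + 1)! : ℂ)) • B ^ (k * (n + 1) - 1)
  have hF : ∀ n s, HasDerivAt (F n)
      (-(B ^ (k - 1) * ((n ! : ℂ)⁻¹ • ((-s) • B ^ k) ^ n))) s := by
    intro n s
    have h1 : HasDerivAt (fun s : ℂ => (-s) ^ (n + 1) / ((n + 1)! : ℂ))
        (-((-s) ^ n * (n ! : ℂ)⁻¹)) s := by
      refine (((hasDerivAt_id s).fun_neg.fun_pow (n + 1)).div_const _).congr_deriv ?_
      have h0 : (n : ℂ) + 1 ≠ 0 := by exact_mod_cast Nat.succ_ne_zero n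
      have h1 : (n ! : ℂ) ≠ 0 := by exact_mod_cast Nat.factorial_ne_zero n
      rw [Nat.factorial_succ]
      push_cast
      field_simp
      simp
    refine (h1.smul_const (B ^ (k * (n + 1) - 1))).congr_deriv ?_
    rw [smul_pow, smul_smul, mul_smul_comm, ← pow_mul, ← pow_add, neg_smul, mul_comm]
    congr 3
    rw [Nat.mul_add_one]
    omega
  -- On the disc of radius `R`, which contains `t`, each term is dominated by its norm at the real
  -- point `R`. This justifies termwise differentiation.
  set R : ℝ := ‖t‖ + 1
  have hball : t ∈ Metric.ball (0 : ℂ) R := by simp [R]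
  have hsum : Summable fun n => ‖F n (R : ℂ)‖ := (summable_expQuot_aux hk (R : ℂ) B).norm
  have hle : ∀ n s, s ∈ Metric.ball (0 : ℂ) R → ‖F n s‖ ≤ ‖F n (R : ℂ)‖ := by
    intro n s hs
    have hR : 0 ≤ R := by positivity
    simp only [F, norm_smul, norm_div, norm_pow, norm_neg, Complex.norm_real, Real.norm_eq_abs,
      abs_of_nonneg hR]
    have : ‖s‖ ≤ R := (mem_ball_zero_iff.1 hs).le
    gcongr
  have hd := Complex.hasSum_deriv_of_summable_norm hsum
    (fun n => (fun s _ => (hF n s).differentiableAt.differentiableWithinAt))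
    Metric.isOpen_ball hle hball
  have hdiff := (Complex.differentiableOn_tsum_of_summable_norm hsum
    (fun n => (fun s _ => (hF n s).differentiableAt.differentiableWithinAt))
    Metric.isOpen_ball hle).differentiableAt (Metric.isOpen_ball.mem_nhds hball)
  have he : HasSum (fun n => deriv (F n) t) (-(B ^ (k - 1) * NormedSpace.exp ((-t) • B ^ k))) := by
    have h1 := ((NormedSpace.exp_series_hasSum_exp' (𝕂 := ℂ) ((-t) • B ^ k)).mul_left
      (B ^ (k - 1))).neg
    have h2 : (fun n => deriv (F n) t)
        = fun n => -(B ^ (k - 1) * ((n ! : ℂ)⁻¹ • ((-t) • B ^ k) ^ n)) :=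
      funext fun n => (hF n t).deriv
    have h3 : HasSum (fun n => -(B ^ (k - 1) * ((n ! : ℂ)⁻¹ • ((-t) • B ^ k) ^ n)))
        (-(B ^ (k - 1) * NormedSpace.exp ((-t) • B ^ k))) := h1
    rwa [← h2] at h3
  rw [← hd.unique he]
  exact hdiff.hasDerivAt

end MatrixCalculus

/-! ### Derivatives along lines and curves of representations. -/

section Flows

open scoped Matrix.Norms.Operator

variable {m : ℕ} [NeZero m] {α : ZMod m → ℕ} {q : ZMod m → ℂˣ}

theorem hasDerivAt_matX_line (p v : Rep α) :
    HasDerivAt (fun s : ℂ => matX (p + s • v)) (matX v) 0 := by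
  have : (fun s : ℂ => matX (p + s • v)) = fun s => matX p + s • matX v := by
    funext s
    ext r s
    simp only [matX, arr, Matrix.add_apply, Matrix.smul_apply]
    split_ifs <;> simp
  rw [this]
  exact (((hasDerivAt_id (0 : ℂ)).smul_const (matX v)).const_add (matX p)).congr_deriv (by simp)

theorem hasDerivAt_matY_line (p v : Rep α) :
    HasDerivAt (fun s : ℂ => matY (p + s • v)) (matY v) 0 := by
  have : (fun s : ℂ => matY (p + s • v)) = fun s => matY p + s • matY v := by
    funext s
    ext r s
    simp only [matY, arr, Matrix.add_apply, Matrix.smul_apply]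
    split_ifs <;> simp
  rw [this]
  exact (((hasDerivAt_id (0 : ℂ)).smul_const (matY v)).const_add (matY p)).congr_deriv (by simp)

theorem hasDerivAt_setXY (p : Rep α) {X Y : ℂ → Matrix (IdxI α) (IdxI α) ℂ}
    {X' Y' : Matrix (IdxI α) (IdxI α) ℂ} {t : ℂ} (hX : HasDerivAt X X' t)
    (hY : HasDerivAt Y Y' t) :
    HasDerivAt (fun s => setXY p (X s) (Y s)) (setXY 0 X' Y') t := by
  have he : ∀ {M : ℂ → Matrix (IdxI α) (IdxI α) ℂ} {M' : Matrix (IdxI α) (IdxI α) ℂ},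
      HasDerivAt M M' t → ∀ r s, HasDerivAt (fun u => extend (M u) r s) (extend M' r s) t := by
    rintro M M' hM ⟨_ | i, a⟩ ⟨_ | j, b⟩
    · exact hasDerivAt_const _ _
    · exact hasDerivAt_const _ _
    · exact hasDerivAt_const _ _
    · exact (LinearMap.toContinuousLinearMap
        (Matrix.entryLinearMap ℂ ℂ (⟨i, a⟩ : IdxI α) ⟨j, b⟩)).hasFDerivAt.comp_hasDerivAt t hM
  rw [hasDerivAt_pi]
  rintro ⟨⟨_ | _ | _ | _, r, s⟩, hc⟩
  · exact he hX r s
  · exact he hY r s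
  · exact hasDerivAt_const _ _
  · exact hasDerivAt_const _ _

end Flows

/-! ### The Hamiltonian fields of `H_k` and `G_k`. -/

section Hamiltonians

variable {m : ℕ} [NeZero m] {α : ZMod m → ℕ} {q : ZMod m → ℂˣ} {k : ℕ}

theorem natCast_pred_mul_neg_one (hk : 0 < k) (hmk : m ∣ k) :
    ((k - 1 : ℕ) : ZMod m) * -1 = 1 := by
  rw [Nat.cast_sub hk, (ZMod.natCast_eq_zero_iff k m).2 hmk]
  simp

theorem natCast_mul_neg_one (hmk : m ∣ k) : (k : ZMod m) * -1 = 0 := by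
  rw [(ZMod.natCast_eq_zero_iff k m).2 hmk, zero_mul]

theorem fderiv_apply_eq_of_line {H : Rep α → ℂ} {p v : Rep α} {a : ℂ}
    (hH : DifferentiableAt ℂ H p) (h : HasDerivAt (fun s : ℂ => H (p + s • v)) a 0) :
    fderiv ℂ H p v = a :=
  HasDerivAt.unique (hH.hasFDerivAt.hasLineDerivAt v) h

theorem fderiv_hamH (hk : 0 < k) (p v : Rep α) :
    fderiv ℂ (hamH α k) p v = (matY p ^ (k - 1) * matY v).trace := by
  have hreg : IsRegular (fun _ => 1) (hamH α k) :=
    (IsRegular.const _).mul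
      ((isRegularMatrix_matY.pow isRegular_one_one k).trace isRegular_one_one)
  refine fderiv_apply_eq_of_line
    (IsRegular.differentiableAt isRegular_one_one hreg one_ne_zero) ?_
  have h := hasDerivAt_trace_pow (hasDerivAt_matY_line p v) hk
  simp only [zero_smul, add_zero] at h
  exact h

/-- The gradients are `Y ^ (k - 1)` and `0`, so invariance amounts to `Y` commuting with its power.
The gradient has degree `1` because `-(k - 1) = 1` modulo `m`. -/
theorem isHamiltonianField_hamH (hk : 0 < k) (hmk : m ∣ k) :
    IsHamiltonianField (detA α) (hamH α k)
      fun p => setXY 0 (-(matY p ^ (k - 1) * (1 + matY p * matX p))) 0 where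
  regular_D := isRegular_detA
  factor := ⟨fun _ => 1, isRegular_one_one, by simp⟩
  inv_D := detA_act
  regular := isRegular_setXY (((isRegularMatrix_matY.pow isRegular_detA _).mul isRegular_detA
    (IsRegularMatrix.one.add isRegular_detA
      (isRegularMatrix_matY.mul isRegular_detA isRegularMatrix_matX))).neg) fun _ _ => .const 0
  equivariant g p _ := by
    have hX := isHomogeneous_matX p
    have hY := isHomogeneous_matY p
    have hA := hY.pow (k - 1)
    rw [natCast_pred_mul_neg_one hk hmk] at hA
    have hYX : IsHomogeneous 0 (1 + matY p * matX p) :=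
      IsHomogeneous.one.add (by simpa using hY.mul hX)
    rw [act_setXY_zero g (Y := 0) (by simpa using (hA.mul hYX).neg) fun _ _ _ => rfl, matX_act,
      matY_act, conjBy_neg, conjBy_mul, conjBy_pow, conjBy_add, conjBy_one, conjBy_mul, conjBy_zero]
  bracket_eq f p _ := by
    have hA := (isHomogeneous_matY p).pow (k - 1)
    rw [natCast_pred_mul_neg_one hk hmk] at hA
    rw [bracket_eq (A := matY p ^ (k - 1)) (B := 0) (fun v => by simp [fderiv_hamH hk p v]) hA
      (fun _ _ _ => rfl) (by simp [pow_mul_comm']), zero_mul]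

theorem isUnit_matX_of_detAX_ne_zero {p : Rep α} (hp : detAX α p ≠ 0) : IsUnit (matX p).det :=
  (right_ne_zero_of_mul hp).isUnit

theorem isRegularMatrix_inv_matX :
    IsRegularMatrix (detAX α) fun p : Rep α => (matX p)⁻¹ :=
  isRegularMatrix_matX.inv isRegular_detAX
    -- Where `detAX ≠ 0`, the inverse of `det X` is `detA / detAX`.
    ((isRegular_detA.of_one.mul IsRegular.one_div).congr fun p hp => by
      have h1 := left_ne_zero_of_mul hp
      have h2 := right_ne_zero_of_mul hp
      rw [detAX]
      field_simp)

theorem isRegularMatrix_matZ : IsRegularMatrix (detAX α) fun p : Rep α => matZ p :=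
  isRegularMatrix_matY.add isRegular_detAX isRegularMatrix_inv_matX

theorem isHomogeneous_matZ {p : Rep α} (hp : IsUnit (matX p)) : IsHomogeneous (-1) (matZ p) :=
  (isHomogeneous_matY p).add ((isHomogeneous_matX p).inv hp)

/-- The second term comes from the derivative `-X⁻¹ X' X⁻¹` of `X⁻¹`, rotated under the trace. -/
theorem fderiv_hamG (hk : 0 < k) {p : Rep α} (hp : detAX α p ≠ 0) (v : Rep α) :
    fderiv ℂ (hamG α k) p v = (matZ p ^ (k - 1) * matY v).trace
      + (-((matX p)⁻¹ * matZ p ^ (k - 1) * (matX p)⁻¹) * matX v).trace := by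
  have hreg : IsRegular (detAX α) (hamG α k) :=
    (IsRegular.const _).mul
      ((isRegularMatrix_matZ.pow isRegular_detAX k).trace isRegular_detAX)
  refine fderiv_apply_eq_of_line
    (IsRegular.differentiableAt isRegular_detAX hreg hp) ?_
  have hu : IsUnit (matX p) :=
    (Matrix.isUnit_iff_isUnit_det _).2 (isUnit_matX_of_detAX_ne_zero hp)
  have h1 := hasDerivAt_matrix_add (hasDerivAt_matY_line p v)
    (hasDerivAt_nonsing_inv (hasDerivAt_matX_line p v) (by simpa using hu))
  have h := hasDerivAt_trace_pow h1 hk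
  refine h.congr_deriv ?_
  simp only [zero_smul, add_zero]
  rw [← matZ, mul_add, Matrix.trace_add, mul_neg, neg_mul, Matrix.trace_neg, Matrix.trace_neg,
    ← mul_assoc, ← mul_assoc, Matrix.trace_mul_comm _ (matX p)⁻¹]
  simp only [mul_assoc]

theorem one_add_matY_mul_matX {p : Rep α} (hp : IsUnit (matX p).det) :
    1 + matY p * matX p = matZ p * matX p := by
  rw [matZ, add_mul, Matrix.nonsing_inv_mul _ hp, add_comm]

theorem one_add_matX_mul_matY {p : Rep α} (hp : IsUnit (matX p).det) :
    1 + matX p * matY p = matX p * matZ p := by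
  rw [matZ, mul_add, Matrix.mul_nonsing_inv _ hp, add_comm]

theorem matZ_act (g : ∀ v : Option (ZMod m), GL (Fin (dim α v)) ℂ) {p : Rep α}
    (hp : IsUnit (matX p).det) : matZ (act g p) = conjBy (baseChange g) (matZ p) := by
  rw [matZ, matZ, matX_act, matY_act, conjBy_add, conjBy_inv _ _ hp]

theorem isHamiltonianField_hamG (hk : 0 < k) (hmk : m ∣ k) :
    IsHamiltonianField (detAX α) (hamG α k)
      fun p => setXY 0 (-(matZ p ^ k * matX p)) (-((matX p)⁻¹ * matZ p ^ k)) where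
  regular_D := isRegular_detAX
  factor := ⟨fun p => (matX p).det, isRegularMatrix_matX.det isRegular_one_one, fun _ => rfl⟩
  inv_D := detAX_act
  regular := isRegular_setXY
    ((isRegularMatrix_matZ.pow isRegular_detAX _).mul isRegular_detAX isRegularMatrix_matX).neg
    (isRegularMatrix_inv_matX.mul isRegular_detAX (isRegularMatrix_matZ.pow isRegular_detAX _)).neg
  equivariant g p hp := by
    have hdet := isUnit_matX_of_detAX_ne_zero hp
    have hu := (Matrix.isUnit_iff_isUnit_det _).2 hdet
    have hX := isHomogeneous_matX p
    have hZ := (isHomogeneous_matZ hu).pow k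
    rw [natCast_mul_neg_one hmk] at hZ
    rw [act_setXY_zero g (by simpa using (hZ.mul hX).neg) (by simpa using ((hX.inv hu).mul hZ).neg),
      matZ_act g hdet, matX_act, conjBy_neg, conjBy_mul, conjBy_pow, conjBy_neg, conjBy_mul,
      conjBy_pow, conjBy_inv _ _ hdet]
  bracket_eq f p hp := by
    have hdet := isUnit_matX_of_detAX_ne_zero hp
    have hu := (Matrix.isUnit_iff_isUnit_det _).2 hdet
    have hX := isHomogeneous_matX p
    have hA := (isHomogeneous_matZ hu).pow (k - 1)
    rw [natCast_pred_mul_neg_one hk hmk] at hA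
    have hB : IsHomogeneous (-1) (-((matX p)⁻¹ * matZ p ^ (k - 1) * (matX p)⁻¹)) := by
      simpa using (((hX.inv hu).mul hA).mul (hX.inv hu)).neg
    have hl : matX p * (matX p)⁻¹ = 1 := Matrix.mul_nonsing_inv _ hdet
    have hr : (matX p)⁻¹ * matX p = 1 := Matrix.nonsing_inv_mul _ hdet
    have hY : matY p = matZ p - (matX p)⁻¹ := by rw [matZ, add_sub_cancel_right]
    -- Substituting `Y = Z - X⁻¹`, the terms with `X⁻¹` cancel on each side, leaving `Z ^ (k - 1) *
    -- Z = Z * Z ^ (k - 1)`.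
    have hAB : matZ p ^ (k - 1) * matY p - matX p * -((matX p)⁻¹ * matZ p ^ (k - 1) * (matX p)⁻¹)
        = matY p * matZ p ^ (k - 1) - -((matX p)⁻¹ * matZ p ^ (k - 1) * (matX p)⁻¹) * matX p := by
      rw [mul_neg, neg_mul, mul_assoc _ (matX p)⁻¹ (matX p), hr, mul_one, ← mul_assoc, ← mul_assoc,
        hl, one_mul, hY, mul_sub, sub_mul, pow_mul_comm']
      abel
    rw [bracket_eq (fderiv_hamG hk hp) hA hB hAB, one_add_matY_mul_matX hdet,
      one_add_matX_mul_matY hdet, ← mul_assoc, pow_sub_one_mul hk.ne']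
    congr 2
    rw [neg_mul, mul_assoc _ (matX p)⁻¹, ← mul_assoc (matX p)⁻¹ (matX p), hr, one_mul, mul_assoc,
      pow_sub_one_mul hk.ne']

end Hamiltonians

/-! ### The explicit flows. -/

section Flows

variable {m : ℕ} [NeZero m] {α : ZMod m → ℕ} {q : ZMod m → ℂˣ} {k : ℕ}

/-- Every exponent `k * (n + 1) - 1` is `-1` modulo `m`, so each power of `B` in the series has
degree `1`. -/
theorem isHomogeneous_expQuot {B : Matrix (IdxI α) (IdxI α) ℂ} (hB : IsHomogeneous (-1) B)
    (hk : 0 < k) (hmk : m ∣ k) (t : ℂ) : IsHomogeneous 1 (expQuot k t B) :=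
  .of_hasSum (summable_expQuot hk t B).hasSum fun n => by
    have := (hB.pow (k * (n + 1) - 1)).smul ((-t) ^ (n + 1) / ((n + 1)! : ℂ))
    rwa [natCast_pred_mul_neg_one (Nat.mul_pos hk n.succ_pos) (hmk.mul_right _)] at this

theorem isHomogeneous_exp_smul_pow {B : Matrix (IdxI α) (IdxI α) ℂ} (hB : IsHomogeneous (-1) B)
    (hmk : m ∣ k) (t : ℂ) : IsHomogeneous 0 (NormedSpace.exp (t • B ^ k)) :=
  .exp <| by
    have := (hB.pow k).smul t
    rwa [natCast_mul_neg_one hmk] at this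

open scoped Matrix.Norms.Operator in
theorem exp_smul_pow_mul_comm {ι : Type*} [Fintype ι] [DecidableEq ι] (t : ℂ) (B : Matrix ι ι ℂ) :
    NormedSpace.exp (t • B ^ k) * B = B * NormedSpace.exp (t • B ^ k) :=
  (((Commute.refl B).pow_right k).smul_right t).exp_right.symm.eq

theorem exists_completeSolution_hamH (hk : 0 < k) (hmk : m ∣ k) (p : repLambda α q) :
    ∃ γ : ℂ → repLambda α q,
      (∀ t : ℂ,
        matX (γ t : Rep α) = NormedSpace.exp ((-t) • matY (p : Rep α) ^ k) * matX (p : Rep α)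
          + expQuot k t (matY (p : Rep α)) ∧
        matY (γ t : Rep α) = matY (p : Rep α) ∧
        matV (γ t : Rep α) = matV (p : Rep α) ∧
        matW (γ t : Rep α) = matW (p : Rep α)) ∧
      IsCompleteSolution (detA α) (hamH α k) p γ := by
  obtain ⟨p, hp⟩ := p
  set X := matX p
  set Y := matY p
  have hX : IsHomogeneous 1 X := isHomogeneous_matX p
  have hY : IsHomogeneous (-1) Y := isHomogeneous_matY p
  set E : ℂ → Matrix (IdxI α) (IdxI α) ℂ := fun t => NormedSpace.exp ((-t) • Y ^ k)
  have hE : ∀ t, IsHomogeneous 0 (E t) := fun t => isHomogeneous_exp_smul_pow hY hmk _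
  have hXt : ∀ t, IsHomogeneous 1 (E t * X + expQuot k t Y) := fun t => by
    simpa using ((hE t).mul hX).add (by simpa using isHomogeneous_expQuot hY hk hmk t)
  have hYE : ∀ t, E t * Y = Y * E t := fun t => exp_smul_pow_mul_comm _ Y
  have hYQ : ∀ t, Y * expQuot k t Y = E t - 1 := fun t => mul_expQuot hk t Y
  -- Since `Y * expQuot k t Y = E t - 1`, the inhomogeneous term is exactly what makes `1 + Y X`
  -- evolve by left multiplication with `E t`; `Y` need not be invertible.
  have hYX : ∀ t, 1 + Y * (E t * X + expQuot k t Y) = E t * (1 + Y * X) := fun t => by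
    rw [mul_add, hYQ, ← mul_assoc, ← hYE, mul_add, mul_one, mul_assoc]
    abel
  have hXY : ∀ t, 1 + (E t * X + expQuot k t Y) * Y = E t * (1 + X * Y) := fun t => by
    rw [add_mul, expQuot_mul_comm hk, hYQ, mul_add, mul_one, mul_assoc]
    abel
  refine ⟨fun t => ⟨setXY p (E t * X + expQuot k t Y) Y, setXY_mem_repLambda hp (hXt t) hY (hE t)
    (Matrix.isUnit_exp _) (hXY t) (hYX t)⟩,
    fun t => ⟨matX_setXY p (hXt t), matY_setXY p hY, rfl, rfl⟩,
    (isHamiltonianField_hamH hk hmk).isCompleteSolution ?_ (fun t => detA_ne_zero (Subtype.prop _))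
      fun t => ?_⟩
  · have h0 : E 0 * X + expQuot k 0 Y = X := by
      have : expQuot k 0 Y = 0 := by simp [expQuot]
      rw [this]
      simp [E]
    exact Subtype.ext (by simp only [h0]; exact setXY_self p)
  · have h1 := hasDerivAt_matrix_add
      (hasDerivAt_matrix_mul_const (hasDerivAt_exp_neg_smul (Y ^ k) t) X) (hasDerivAt_expQuot hk t Y)
    refine (hasDerivAt_setXY p h1 (hasDerivAt_matrix_const Y t)).congr_deriv ?_
    simp only
    rw [matX_setXY p (hXt t), matY_setXY p hY, hYX]
    congr 1
    show -(Y ^ k * E t) * X + -(Y ^ (k - 1) * E t) = -(Y ^ (k - 1) * (E t * (1 + Y * X)))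
    rw [← pow_sub_one_mul hk.ne' Y, mul_add (E t), mul_one, ← mul_assoc (E t), hYE]
    noncomm_ring

theorem exists_completeSolution_hamG (hk : 0 < k) (hmk : m ∣ k) (p : repLambda α q)
    (hpX : IsUnit (matX (p : Rep α))) : ∃ γ : ℂ → repLambda α q,
      (∀ t : ℂ,
        matX (γ t : Rep α) = NormedSpace.exp ((-t) • matZ (p : Rep α) ^ k) * matX (p : Rep α) ∧
        IsUnit (matX (γ t : Rep α)) ∧
        matZ (γ t : Rep α) = matZ (p : Rep α) ∧
        matV (γ t : Rep α) = matV (p : Rep α) ∧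
        matW (γ t : Rep α) = matW (p : Rep α)) ∧
      IsCompleteSolution (detAX α) (hamG α k) p γ := by
  obtain ⟨p, hp⟩ := p
  change IsUnit (matX p) at hpX
  have hdet := (Matrix.isUnit_iff_isUnit_det _).1 hpX
  have hXZ := one_add_matX_mul_matY hdet
  have hZX := one_add_matY_mul_matX hdet
  have hX : IsHomogeneous 1 (matX p) := isHomogeneous_matX p
  have hZ : IsHomogeneous (-1) (matZ p) := isHomogeneous_matZ hpX
  have hYZ : matZ p - (matX p)⁻¹ = matY p := by rw [matZ, add_sub_cancel_right]
  show ∃ γ : ℂ → repLambda α q, (∀ t : ℂ, matX (γ t : Rep α) = _ * matX p ∧ _ ∧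
    matZ (γ t : Rep α) = matZ p ∧ _) ∧ _
  set X := matX p
  set Z := matZ p
  set E : ℂ → Matrix (IdxI α) (IdxI α) ℂ := fun t => NormedSpace.exp ((-t) • Z ^ k)
  set E' : ℂ → Matrix (IdxI α) (IdxI α) ℂ := fun t => NormedSpace.exp (t • Z ^ k)
  have hE : ∀ t, IsHomogeneous 0 (E t) := fun t => isHomogeneous_exp_smul_pow hZ hmk _
  have hE' : ∀ t, IsHomogeneous 0 (E' t) := fun t => isHomogeneous_exp_smul_pow hZ hmk _
  have hEu : ∀ t, IsUnit (E t) := fun t => Matrix.isUnit_exp _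
  have hEE' : ∀ t, (E t)⁻¹ = E' t := fun t => by
    simp only [E, E']
    rw [← Matrix.exp_neg, neg_smul, neg_neg]
  have hE'E : ∀ t, E' t * E t = 1 := fun t => by
    rw [← hEE']
    exact Matrix.nonsing_inv_mul _ ((Matrix.isUnit_iff_isUnit_det _).1 (hEu t))
  have hEE : ∀ t, E t * E' t = 1 := fun t => by
    rw [← hEE']
    exact Matrix.mul_nonsing_inv _ ((Matrix.isUnit_iff_isUnit_det _).1 (hEu t))
  have hXt : ∀ t, IsHomogeneous 1 (E t * X) := fun t => by simpa using (hE t).mul hX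
  -- Constancy of `Z = Y + X⁻¹` dictates `Y(t) = Z - X(t)⁻¹`, and `X(t)⁻¹ = X⁻¹ * E' t` with `E' t`
  -- inverse to `E t`.
  have hYt : ∀ t, IsHomogeneous (-1) (Z - X⁻¹ * E' t) := fun t => by
    rw [sub_eq_add_neg]
    exact hZ.add (by simpa using ((hX.inv hpX).mul (hE' t)).neg)
  have hZE : ∀ t, E t * Z = Z * E t := fun t => exp_smul_pow_mul_comm _ Z
  have hXinv : ∀ t, (E t * X)⁻¹ = X⁻¹ * E' t := fun t => by rw [Matrix.mul_inv_rev, hEE']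
  have hYX : ∀ t, 1 + (Z - X⁻¹ * E' t) * (E t * X) = E t * (1 + matY p * X) := fun t => by
    rw [hZX, sub_mul, mul_assoc X⁻¹, ← mul_assoc (E' t), hE'E, one_mul,
      Matrix.nonsing_inv_mul _ hdet, add_sub_cancel, ← mul_assoc, ← hZE, mul_assoc]
  have hXY : ∀ t, 1 + (E t * X) * (Z - X⁻¹ * E' t) = E t * (1 + X * matY p) := fun t => by
    rw [hXZ, mul_sub, mul_assoc (E t) X (X⁻¹ * E' t), ← mul_assoc X,
      Matrix.mul_nonsing_inv _ hdet, one_mul, hEE, add_sub_cancel, mul_assoc]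
  have hu : ∀ t, IsUnit (E t * X) := fun t => (hEu t).mul hpX
  have hZt : ∀ t, matZ (setXY p (E t * X) (Z - X⁻¹ * E' t)) = Z := fun t => by
    rw [matZ, matX_setXY p (hXt t), matY_setXY p (hYt t), hXinv, sub_add_cancel]
  refine ⟨fun t => ⟨setXY p (E t * X) (Z - X⁻¹ * E' t), setXY_mem_repLambda hp (hXt t) (hYt t)
    (hE t) (hEu t) (hXY t) (hYX t)⟩,
    fun t => ⟨matX_setXY p (hXt t), (matX_setXY p (hXt t)).symm ▸ hu t, hZt t, rfl, rfl⟩,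
    (isHamiltonianField_hamG hk hmk).isCompleteSolution ?_ (fun t => ?_) fun t => ?_⟩
  · have h0 : E 0 = 1 := by simp [E]
    have h0' : E' 0 = 1 := by simp [E']
    exact Subtype.ext (by simp only [h0, h0', one_mul, mul_one, hYZ]; exact setXY_self p)
  · refine mul_ne_zero (detA_ne_zero (Subtype.prop _)) ?_
    rw [matX_setXY p (hXt t)]
    exact ((Matrix.isUnit_iff_isUnit_det _).1 (hu t)).ne_zero
  · have h1 := hasDerivAt_matrix_mul_const (hasDerivAt_exp_neg_smul (Z ^ k) t) X
    have h2 := hasDerivAt_matrix_const_sub_mul (hasDerivAt_exp_smul (Z ^ k) t) Z X⁻¹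
    refine (hasDerivAt_setXY p h1 h2).congr_deriv ?_
    simp only
    rw [hZt, matX_setXY p (hXt t), hXinv]
    congr 1
    · rw [neg_mul, mul_assoc]
    · rw [mul_assoc]

end Flows

end

end CyclicQuiver


theorem proposition4p4 (m : ℕ) [NeZero m] (hm : 2 ≤ m) (α : ZMod m → ℕ) (q : ZMod m → ℂˣ)
    (k : ℕ) (hk : 0 < k) (hmk : m ∣ k) :
    (∀ p : repLambda α q, ∃ γ : ℂ → repLambda α q,
      (∀ t : ℂ,
        matX (γ t : Rep α) = NormedSpace.exp ((-t) • matY (p : Rep α) ^ k) * matX (p : Rep α)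
          + expQuot k t (matY (p : Rep α)) ∧
        matY (γ t : Rep α) = matY (p : Rep α) ∧
        matV (γ t : Rep α) = matV (p : Rep α) ∧
        matW (γ t : Rep α) = matW (p : Rep α)) ∧
      IsCompleteSolution (detA α) (hamH α k) p γ) ∧
    (∀ p : repLambda α q, IsUnit (matX (p : Rep α)) → ∃ γ : ℂ → repLambda α q,
      (∀ t : ℂ,
        matX (γ t : Rep α) = NormedSpace.exp ((-t) • matZ (p : Rep α) ^ k) * matX (p : Rep α) ∧
        IsUnit (matX (γ t : Rep α)) ∧
        matZ (γ t : Rep α) = matZ (p : Rep α) ∧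
        matV (γ t : Rep α) = matV (p : Rep α) ∧
        matW (γ t : Rep α) = matW (p : Rep α)) ∧
      IsCompleteSolution (detAX α) (hamG α k) p γ) :=
  ⟨exists_completeSolution_hamH hk hmk, exists_completeSolution_hamG hk hmk⟩
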